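/- Let $(M,g)$ be a compact smooth Riemannian manifold (Hausdorff, without boundary, not necessarily connected), let $\lambda,\mu\in\mathbb C$, and let $f:M\to\mathbb C$ be a smooth $(\lambda,\mu)$-eigenfunction, i.e. $$\Delta f=\lambda f,\qquad \kappa(f,f)=\mu f^2\qquad\text{on } M.$$ Here $\Delta$ is the complex-linear Laplace-Beltrami operator, given in local coordinates by $$\Delta\varphi=\sum_{i,j}\frac1{\sqrt{|g|}}\frac{\partial}{\partial x_j}\Big(g^{ij}\sqrt{|g|}\,\frac{\partial\varphi}{\partial x_i}\Big),$$ and $\kappa(\varphi,\psi)=g(\nabla\varphi,\nabla\psi)$ is the conformality operator, where $g$ is extended to a complex bilinear form on the complexified tangent bundle. Assume that $f$ is not locally constant (if $M$ is connected: that $f$ is not constant). Then $\lambda$ and $\mu$ are real and $$\lambda\le\mu<0.$$ -/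

import Mathlib

open scoped Manifold ContDiff TensorProduct

noncomputable section

namespace RiemannianEigen

variable {m : ℕ} {M : Type*} [TopologicalSpace M] [ChartedSpace (EuclideanSpace ℝ (Fin m)) M]
  [IsManifold (𝓡 m) ∞ M]

variable (m M) in
/-- A smooth Riemannian metric on the `m`-dimensional manifold (without boundary) `M`. -/
abbrev Metric : Type _ :=
  Bundle.ContMDiffRiemannianMetric (𝓡 m) ∞ (EuclideanSpace ℝ (Fin m))
    (fun x : M ↦ TangentSpace (𝓡 m) x)

instance finiteDimensional_tangentSpace (x : M) :
    FiniteDimensional ℝ (TangentSpace (𝓡 m) x) :=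
  inferInstanceAs (FiniteDimensional ℝ (EuclideanSpace ℝ (Fin m)))

/-- The metric at the point `x`, as a real bilinear form on the tangent space at `x`. -/
def metricForm (g : Metric m M) (x : M) : LinearMap.BilinForm ℝ (TangentSpace (𝓡 m) x) :=
  LinearMap.mk₂ ℝ (fun v w ↦ g.inner x v w) (by simp) (by simp) (by simp) (by simp)

theorem metricForm_nondegenerate (g : Metric m M) (x : M) : (metricForm g x).Nondegenerate := by
  constructor
  · intro v hv
    by_contra h
    exact (g.pos x v h).ne' (hv v)
  · intro v hv
    by_contra h
    exact (g.pos x v h).ne' (hv v)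

/-- The gradient at `x` of a real function `u`: the tangent vector `∇u` with
`g(∇u, v) = du(v)` for all tangent vectors `v` at `x`. -/
def realGradient (g : Metric m M) (u : M → ℝ) (x : M) : TangentSpace (𝓡 m) x :=
  (LinearMap.BilinForm.toDual (metricForm g x) (metricForm_nondegenerate g x)).symm
    (mfderiv (𝓡 m) 𝓘(ℝ, ℝ) u x : TangentSpace (𝓡 m) x →L[ℝ] ℝ).toLinearMap

/-- The characteristic property of the gradient. -/
theorem metricForm_realGradient (g : Metric m M) (u : M → ℝ) (x : M) (v : TangentSpace (𝓡 m) x) :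
    metricForm g x (realGradient g u x) v =
      (mfderiv (𝓡 m) 𝓘(ℝ, ℝ) u x : TangentSpace (𝓡 m) x →L[ℝ] ℝ) v := by
  exact LinearMap.BilinForm.apply_toDual_symm_apply (hB := metricForm_nondegenerate g x) _ v

/-- The gradient of a complex function, a vector of the complexified tangent space. -/
def gradient (g : Metric m M) (φ : M → ℂ) (x : M) : ℂ ⊗[ℝ] TangentSpace (𝓡 m) x :=
  (1 : ℂ) ⊗ₜ[ℝ] realGradient g (fun z ↦ (φ z).re) x +
    Complex.I ⊗ₜ[ℝ] realGradient g (fun z ↦ (φ z).im) x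

/-- The conformality operator `κ(φ, ψ) = g(∇φ, ∇ψ)`, where `g` is extended to a complex bilinear
form on the complexified tangent space. -/
def conformality (g : Metric m M) (φ ψ : M → ℂ) (x : M) : ℂ :=
  LinearMap.BilinForm.baseChange ℂ (metricForm g x) (gradient g φ x) (gradient g ψ x)

/-- The coordinate vector field `∂/∂xᵢ` of a chart `e`, at the point with coordinates `y`. -/
def coordVector (e : OpenPartialHomeomorph M (EuclideanSpace ℝ (Fin m))) (i : Fin m)
    (y : EuclideanSpace ℝ (Fin m)) : TangentSpace (𝓡 m) (e.symm y) :=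
  mfderiv 𝓘(ℝ, EuclideanSpace ℝ (Fin m)) (𝓡 m) e.symm y (EuclideanSpace.single i (1 : ℝ))

/-- The matrix `(g_{ij})` of the metric in a chart `e`, at the point with coordinates `y`. -/
def metricMatrix (g : Metric m M) (e : OpenPartialHomeomorph M (EuclideanSpace ℝ (Fin m)))
    (y : EuclideanSpace ℝ (Fin m)) : Matrix (Fin m) (Fin m) ℝ :=
  Matrix.of fun i j ↦ g.inner (e.symm y) (coordVector e i y) (coordVector e j y)

/-- The expression of the Laplace-Beltrami operator in the local coordinates of a chart `e`,
`Δφ = ∑ᵢⱼ |g|^(-1/2) ∂/∂xⱼ (g^{ij} |g|^(1/2) ∂φ/∂xᵢ)`, at a point `x` of the domain of `e`. -/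
def laplacianInChart (g : Metric m M) (e : OpenPartialHomeomorph M (EuclideanSpace ℝ (Fin m)))
    (φ : M → ℂ) (x : M) : ℂ :=
  ∑ i : Fin m, ∑ j : Fin m, ((1 / √((metricMatrix g e (e x)).det) : ℝ) : ℂ) *
    fderiv ℝ
      (fun y ↦ (((metricMatrix g e y)⁻¹ i j * √((metricMatrix g e y).det) : ℝ) : ℂ) *
        fderiv ℝ (fun z ↦ φ (e.symm z)) y (EuclideanSpace.single i (1 : ℝ)))
      (e x) (EuclideanSpace.single j (1 : ℝ))

/-- `Δφ = ψ`, where `Δ` is the Laplace-Beltrami operator: the equation holds in all local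
coordinates of the smooth manifold `M`. (For smooth `φ` the expression in coordinates does not
depend on the chart.) -/
def LaplaceBeltramiEq (g : Metric m M) (φ ψ : M → ℂ) : Prop :=
  ∀ e ∈ IsManifold.maximalAtlas (𝓡 m) ∞ M, ∀ x ∈ e.source, laplacianInChart g e φ x = ψ x

/-- A smooth function `φ : M → ℂ` is a `(lam, mu)`-eigenfunction if `Δφ = lam φ` and
`κ(φ, φ) = mu φ²`. -/
structure IsEigenfunction (g : Metric m M) (lam mu : ℂ) (φ : M → ℂ) : Prop where
  smooth : ContMDiff (𝓡 m) 𝓘(ℝ, ℂ) ∞ φ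
  laplacian : LaplaceBeltramiEq g φ (fun x ↦ lam * φ x)
  conformality : ∀ x, conformality g φ φ x = mu * φ x ^ 2

end RiemannianEigen

end

set_option linter.unusedSectionVars false
open MeasureTheory
noncomputable section
namespace RiemannianEigen
variable {m : ℕ} {M : Type*} [TopologicalSpace M] [ChartedSpace (EuclideanSpace ℝ (Fin m)) M]
  [IsManifold (𝓡 m) ∞ M]

/-! The proof combines one global fact with a local analysis at a single point.

Globally, Green's formula with test function the conjugate of `f` gives `lam * ∫ |f|² = -∫ |∇f|²`.
Both integrals are real, and the right one is nonzero because `f` is not locally constant. Hence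
`lam` is real and nonzero (`laplacian_eigenvalue`). The Riemannian integral is built by hand from
charts and a finite partition of unity, and Green's formula reduces to Euclidean integration by
parts in one chart (`chartIntegral_mul_laplacian`).

Locally, let `p` be a maximum point of `|f|` and `c = f p ≠ 0`. The first-order condition says that
`conj c * ∂ᵢf` is purely imaginary, so `∂ᵢf = I * c * ζᵢ` with `ζ` real. Then `κ(f, f) = mu f²`
becomes `mu = -q`, where `q` is the squared norm of the covector `ζ`; thus `mu` is real and
nonpositive. The second-order condition, traced against the inverse metric, gives `lam.re + q ≤ 0`,
that is `lam.re ≤ mu.re`: the first-order terms of `Δ` have real coefficients and drop out of the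
real part.

It remains to exclude `mu = 0`. In that case `ζ = 0`, so `p` is a critical point, and `κ(f, f)`
vanishes identically. Its second-order part at `p` yields `H A H = 0`, with `A` the inverse metric
and `H` the Hessian. So `A H` is nilpotent and has trace zero
(`sum_mul_eq_zero_of_quadratic_eq_zero`), which means `Δf` vanishes at `p`. Then `lam * c = 0`,
against `lam ≠ 0`. All this local work is in `IsEigenfunction.of_isMax`. -/

theorem contMDiff_constant_section {V : Type*} [NormedAddCommGroup V] [NormedSpace ℝ V] (v : V) :
    ContMDiff 𝓘(ℝ, V) 𝓘(ℝ, V).tangent ∞ (fun y : V ↦ (⟨y, v⟩ : TangentBundle 𝓘(ℝ, V) V)) :=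
  contMDiff_vectorSpace_iff_contDiff.2 contDiff_const

/-! ### The metric and the conformality operator in coordinates -/

section Charts

variable {g : Metric m M} {e : OpenPartialHomeomorph M (EuclideanSpace ℝ (Fin m))}

theorem mdifferentiable_of_mem_maximalAtlas (he : e ∈ IsManifold.maximalAtlas (𝓡 m) ∞ M) :
    e.MDifferentiable (𝓡 m) (𝓡 m) :=
  ⟨(contMDiffOn_of_mem_maximalAtlas he).mdifferentiableOn (by simp),
    (contMDiffOn_symm_of_mem_maximalAtlas he).mdifferentiableOn (by simp)⟩

theorem mdifferentiableAt_symm (he : e ∈ IsManifold.maximalAtlas (𝓡 m) ∞ M)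
    {y : EuclideanSpace ℝ (Fin m)} (hy : y ∈ e.target) :
    MDifferentiableAt (𝓡 m) (𝓡 m) e.symm y :=
  (mdifferentiable_of_mem_maximalAtlas he).symm.mdifferentiableAt hy

theorem mfderiv_symm_bijective (he : e ∈ IsManifold.maximalAtlas (𝓡 m) ∞ M)
    {y : EuclideanSpace ℝ (Fin m)} (hy : y ∈ e.target) :
    Function.Bijective (mfderiv (𝓡 m) (𝓡 m) e.symm y) :=
  (mdifferentiable_of_mem_maximalAtlas he).symm.mfderiv_bijective hy

/-- The vector field with constant coordinates `c` in a chart. -/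
theorem sum_smul_coordVector (c : Fin m → ℝ) (y : EuclideanSpace ℝ (Fin m)) :
    ∑ i, c i • coordVector e i y = mfderiv (𝓡 m) (𝓡 m) e.symm y (WithLp.toLp 2 c) := by
  have h : (WithLp.toLp 2 c : EuclideanSpace ℝ (Fin m)) =
      ∑ i, c i • EuclideanSpace.single i (1 : ℝ) := by
    ext j
    simp [Finset.sum_apply, Pi.single_apply]
  unfold coordVector
  rw [h]
  erw [map_sum]
  exact Finset.sum_congr rfl fun i _ ↦ by erw [map_smul]

theorem exists_eq_sum_smul_coordVector (he : e ∈ IsManifold.maximalAtlas (𝓡 m) ∞ M)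
    {y : EuclideanSpace ℝ (Fin m)} (hy : y ∈ e.target) (v : TangentSpace (𝓡 m) (e.symm y)) :
    ∃ c : Fin m → ℝ, v = ∑ i, c i • coordVector e i y := by
  obtain ⟨w, hw⟩ := (mfderiv_symm_bijective he hy).2 v
  exact ⟨WithLp.ofLp w, by rw [sum_smul_coordVector]; exact hw.symm⟩

/-- The coordinate fields are smooth sections, being images of constant fields under the tangent map
of `e.symm`; the smooth bundle metric is then applied to two of them. -/
theorem contDiffOn_metricMatrix (g : Metric m M) (he : e ∈ IsManifold.maximalAtlas (𝓡 m) ∞ M)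
    (i j : Fin m) : ContDiffOn ℝ ∞ (fun y ↦ metricMatrix g e y i j) e.target := by
  have hsec (k : Fin m) : ContMDiffOn (𝓡 m) (𝓡 m).tangent ∞
      (fun y ↦ (⟨e.symm y, coordVector e k y⟩ : TangentBundle (𝓡 m) M)) e.target := by
    have h1 := (contMDiffOn_symm_of_mem_maximalAtlas he).contMDiffOn_tangentMapWithin
      (m := ∞) le_rfl e.open_target.uniqueMDiffOn
    have h2 : ContMDiffOn (𝓡 m) (𝓡 m).tangent ∞
        (fun y : EuclideanSpace ℝ (Fin m) ↦ (⟨y, EuclideanSpace.single k (1 : ℝ)⟩ :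
          TangentBundle (𝓡 m) (EuclideanSpace ℝ (Fin m)))) e.target := by
      exact (contMDiff_constant_section (EuclideanSpace.single k (1 : ℝ))).contMDiffOn
    refine (h1.comp h2 (fun y hy ↦ hy)).congr fun y hy ↦ ?_
    simp only [Function.comp, tangentMapWithin, coordVector]
    rw [mfderivWithin_of_isOpen e.open_target hy]
  have h3 := ContMDiffOn.clm_bundle_apply₂ (F₁ := EuclideanSpace ℝ (Fin m))
    (F₂ := EuclideanSpace ℝ (Fin m)) (F₃ := ℝ) (E₃ := fun _ : M ↦ ℝ)
    (g.contMDiff.comp_contMDiffOn (contMDiffOn_symm_of_mem_maximalAtlas he)) (hsec i) (hsec j)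
  rw [← contMDiffOn_iff_contDiffOn]
  intro y hy
  have h4 := h3 y hy
  simp only [Bundle.contMDiffWithinAt_totalSpace] at h4
  exact h4.2

theorem metricMatrix_comm (i j : Fin m) (y : EuclideanSpace ℝ (Fin m)) :
    metricMatrix g e y i j = metricMatrix g e y j i :=
  g.symm _ _ _

theorem dotProduct_metricMatrix_mulVec (c d : Fin m → ℝ) (y : EuclideanSpace ℝ (Fin m)) :
    c ⬝ᵥ (metricMatrix g e y).mulVec d =
      metricForm g (e.symm y) (∑ i, c i • coordVector e i y) (∑ i, d i • coordVector e i y) := by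
  simp only [map_sum, map_smul, LinearMap.sum_apply, LinearMap.smul_apply, smul_eq_mul,
    dotProduct, Matrix.mulVec, Finset.mul_sum]
  rw [Finset.sum_comm]
  refine Finset.sum_congr rfl fun i _ ↦ Finset.sum_congr rfl fun j _ ↦ ?_
  simp only [metricMatrix, Matrix.of_apply, metricForm, LinearMap.mk₂_apply]
  ring

theorem posDef_metricMatrix (g : Metric m M) (he : e ∈ IsManifold.maximalAtlas (𝓡 m) ∞ M)
    {y : EuclideanSpace ℝ (Fin m)} (hy : y ∈ e.target) : (metricMatrix g e y).PosDef := by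
  refine Matrix.PosDef.of_dotProduct_mulVec_pos ?_ fun c hc ↦ ?_
  · ext i j
    exact metricMatrix_comm _ _ _
  · rw [star_trivial, dotProduct_metricMatrix_mulVec]
    refine g.pos _ _ fun h ↦ hc ?_
    rw [sum_smul_coordVector] at h
    have := (mfderiv_symm_bijective he hy).1 (h.trans (map_zero _).symm)
    exact congrArg WithLp.ofLp this

/-- If `X` has coefficient row `c`, then `α = c G`, so `c = α G⁻¹`. Applied to gradients, this turns
`g(∇u, ∇v)` into `g^{ij} ∂ᵢu ∂ⱼv`. -/
theorem bilin_eq_sum_inv_mul {V : Type*} [AddCommGroup V] [Module ℝ V]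
    (B : LinearMap.BilinForm ℝ V) (b : Fin m → V) (G : Matrix (Fin m) (Fin m) ℝ)
    (hG : ∀ i j, G i j = B (b i) (b j)) (hdet : IsUnit G.det) {X Y : V} {α β : Fin m → ℝ}
    (hX : ∃ c : Fin m → ℝ, X = ∑ i, c i • b i) (hα : ∀ i, B X (b i) = α i)
    (hβ : ∀ i, B (b i) Y = β i) : B X Y = ∑ i, ∑ j, G⁻¹ i j * (α i * β j) := by
  obtain ⟨c, hc⟩ := hX
  have h1 : α = Matrix.vecMul c G := by
    ext j
    rw [← hα j, hc]
    simp [Matrix.vecMul, dotProduct, hG]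
  have h2 : c = Matrix.vecMul α G⁻¹ := by
    rw [h1, Matrix.vecMul_vecMul, Matrix.mul_nonsing_inv _ hdet, Matrix.vecMul_one]
  have h3 : B X Y = ∑ j, c j * β j := by
    rw [hc]
    simp [hβ]
  rw [h3, h2, Finset.sum_comm]
  simp only [Matrix.vecMul, dotProduct, Finset.sum_mul]
  exact Finset.sum_congr rfl fun i _ ↦ Finset.sum_congr rfl fun j _ ↦ by ring

/-- The partial derivative `∂φ/∂xᵢ` of a complex function in the coordinates of a chart. -/
def chartDeriv (e : OpenPartialHomeomorph M (EuclideanSpace ℝ (Fin m))) (φ : M → ℂ) (i : Fin m)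
    (y : EuclideanSpace ℝ (Fin m)) : ℂ :=
  fderiv ℝ (fun z ↦ φ (e.symm z)) y (EuclideanSpace.single i (1 : ℝ))

theorem mfderiv_coordVector (he : e ∈ IsManifold.maximalAtlas (𝓡 m) ∞ M) {u : M → ℝ}
    {y : EuclideanSpace ℝ (Fin m)} (hy : y ∈ e.target)
    (hu : MDifferentiableAt (𝓡 m) 𝓘(ℝ, ℝ) u (e.symm y)) (i : Fin m) :
    (mfderiv (𝓡 m) 𝓘(ℝ, ℝ) u (e.symm y) : TangentSpace (𝓡 m) (e.symm y) →L[ℝ] ℝ)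
      (coordVector e i y) =
      fderiv ℝ (fun z ↦ u (e.symm z)) y (EuclideanSpace.single i (1 : ℝ)) := by
  have h := mfderiv_comp y hu (mdifferentiableAt_symm he hy)
  rw [← mfderiv_eq_fderiv]
  change _ = mfderiv _ _ (u ∘ e.symm) y (EuclideanSpace.single i (1 : ℝ))
  rw [h]
  rfl

theorem metricForm_realGradient_realGradient (g : Metric m M)
    (he : e ∈ IsManifold.maximalAtlas (𝓡 m) ∞ M) {u v : M → ℝ}
    {y : EuclideanSpace ℝ (Fin m)} (hy : y ∈ e.target)
    (hu : MDifferentiableAt (𝓡 m) 𝓘(ℝ, ℝ) u (e.symm y))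
    (hv : MDifferentiableAt (𝓡 m) 𝓘(ℝ, ℝ) v (e.symm y)) :
    metricForm g (e.symm y) (realGradient g u (e.symm y)) (realGradient g v (e.symm y)) =
      ∑ i, ∑ j, (metricMatrix g e y)⁻¹ i j *
        (fderiv ℝ (fun z ↦ u (e.symm z)) y (EuclideanSpace.single i (1 : ℝ)) *
          fderiv ℝ (fun z ↦ v (e.symm z)) y (EuclideanSpace.single j (1 : ℝ))) := by
  refine bilin_eq_sum_inv_mul (metricForm g (e.symm y)) (fun i ↦ coordVector e i y) _
    (fun i j ↦ rfl) (posDef_metricMatrix g he hy).det_pos.ne'.isUnit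
    (exists_eq_sum_smul_coordVector he hy _) (fun i ↦ ?_) (fun i ↦ ?_)
  · rw [metricForm_realGradient, mfderiv_coordVector he hy hu]
  · have : metricForm g (e.symm y) (coordVector e i y) (realGradient g v (e.symm y)) =
        metricForm g (e.symm y) (realGradient g v (e.symm y)) (coordVector e i y) :=
      g.symm _ _ _
    rw [this, metricForm_realGradient, mfderiv_coordVector he hy hv]

theorem conformality_eq (g : Metric m M) (φ ψ : M → ℂ) (x : M) :
    conformality g φ ψ x =
      metricForm g x (realGradient g (fun z ↦ (φ z).re) x) (realGradient g (fun z ↦ (ψ z).re) x)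
      - metricForm g x (realGradient g (fun z ↦ (φ z).im) x) (realGradient g (fun z ↦ (ψ z).im) x)
      + (metricForm g x (realGradient g (fun z ↦ (φ z).re) x) (realGradient g (fun z ↦ (ψ z).im) x)
      + metricForm g x (realGradient g (fun z ↦ (φ z).im) x)
        (realGradient g (fun z ↦ (ψ z).re) x)) * Complex.I := by
  simp only [conformality, gradient, map_add, LinearMap.add_apply,
    LinearMap.BilinForm.baseChange_tmul, mul_one, one_mul, Complex.real_smul, Complex.I_mul_I]
  ring

/-- Both sides are complex bilinear in the derivatives of `φ` and `ψ`, so the real coordinate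
formula for the four pairings of real and imaginary parts suffices. -/
theorem conformality_symm_apply (g : Metric m M) (he : e ∈ IsManifold.maximalAtlas (𝓡 m) ∞ M)
    {φ ψ : M → ℂ} (hφ : ContMDiff (𝓡 m) 𝓘(ℝ, ℂ) ∞ φ) (hψ : ContMDiff (𝓡 m) 𝓘(ℝ, ℂ) ∞ ψ)
    {y : EuclideanSpace ℝ (Fin m)} (hy : y ∈ e.target) :
    conformality g φ ψ (e.symm y) =
      ∑ i, ∑ j, ((metricMatrix g e y)⁻¹ i j : ℂ) * (chartDeriv e φ i y * chartDeriv e ψ j y) := by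
  have hre {χ : M → ℂ} (hχ : ContMDiff (𝓡 m) 𝓘(ℝ, ℂ) ∞ χ) :
      MDifferentiableAt (𝓡 m) 𝓘(ℝ, ℝ) (fun z ↦ (χ z).re) (e.symm y) :=
    ((Complex.reCLM.contDiff.contMDiff (n := ∞)).comp hχ).mdifferentiableAt (by simp)
  have him {χ : M → ℂ} (hχ : ContMDiff (𝓡 m) 𝓘(ℝ, ℂ) ∞ χ) :
      MDifferentiableAt (𝓡 m) 𝓘(ℝ, ℝ) (fun z ↦ (χ z).im) (e.symm y) :=
    ((Complex.imCLM.contDiff.contMDiff (n := ∞)).comp hχ).mdifferentiableAt (by simp)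
  have hd {χ : M → ℂ} (hχ : ContMDiff (𝓡 m) 𝓘(ℝ, ℂ) ∞ χ) :
      DifferentiableAt ℝ (fun z ↦ χ (e.symm z)) y :=
    ((hχ.mdifferentiableAt (by simp)).comp y (mdifferentiableAt_symm he hy)).differentiableAt
  have hdre {χ : M → ℂ} (hχ : ContMDiff (𝓡 m) 𝓘(ℝ, ℂ) ∞ χ) (i : Fin m) :
      fderiv ℝ (fun z ↦ (χ (e.symm z)).re) y (EuclideanSpace.single i (1 : ℝ)) =
        (chartDeriv e χ i y).re := by
    have := (Complex.reCLM.hasFDerivAt.comp y (hd hχ).hasFDerivAt).fderiv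
    exact congrArg (· (EuclideanSpace.single i (1 : ℝ))) this
  have hdim {χ : M → ℂ} (hχ : ContMDiff (𝓡 m) 𝓘(ℝ, ℂ) ∞ χ) (i : Fin m) :
      fderiv ℝ (fun z ↦ (χ (e.symm z)).im) y (EuclideanSpace.single i (1 : ℝ)) =
        (chartDeriv e χ i y).im := by
    have := (Complex.imCLM.hasFDerivAt.comp y (hd hχ).hasFDerivAt).fderiv
    exact congrArg (· (EuclideanSpace.single i (1 : ℝ))) this
  rw [conformality_eq, metricForm_realGradient_realGradient g he hy (hre hφ) (hre hψ),
    metricForm_realGradient_realGradient g he hy (him hφ) (him hψ),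
    metricForm_realGradient_realGradient g he hy (hre hφ) (him hψ),
    metricForm_realGradient_realGradient g he hy (him hφ) (hre hψ)]
  simp only [hdre hφ, hdre hψ, hdim hφ, hdim hψ]
  push_cast
  simp only [← Finset.sum_sub_distrib, ← Finset.sum_add_distrib, Finset.sum_mul]
  refine Finset.sum_congr rfl fun i _ ↦ Finset.sum_congr rfl fun j _ ↦ ?_
  have h1 := Complex.re_add_im (chartDeriv e φ i y)
  have h2 := Complex.re_add_im (chartDeriv e ψ j y)
  linear_combination ((metricMatrix g e y)⁻¹ i j : ℂ) *
      ((chartDeriv e ψ j y).re + (chartDeriv e ψ j y).im * Complex.I) * h1 +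
    ((metricMatrix g e y)⁻¹ i j : ℂ) * chartDeriv e φ i y * h2 -
    ((metricMatrix g e y)⁻¹ i j : ℂ) * (chartDeriv e φ i y).im * (chartDeriv e ψ j y).im *
      Complex.I_sq

end Charts

/-! ### Smoothness of the coordinate expressions -/

section Smoothness

theorem contDiffOn_det {V : Type*} [NormedAddCommGroup V] [NormedSpace ℝ V] {s : Set V}
    {A : V → Matrix (Fin m) (Fin m) ℝ} (hA : ∀ i j, ContDiffOn ℝ ∞ (fun y ↦ A y i j) s) :
    ContDiffOn ℝ ∞ (fun y ↦ (A y).det) s := by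
  simp only [Matrix.det_apply]
  refine ContDiffOn.sum fun σ _ ↦ ContDiffOn.const_smul _ ?_
  exact contDiffOn_prod fun i _ ↦ hA _ _

theorem contDiffOn_inv {V : Type*} [NormedAddCommGroup V] [NormedSpace ℝ V] {s : Set V}
    {A : V → Matrix (Fin m) (Fin m) ℝ} (hA : ∀ i j, ContDiffOn ℝ ∞ (fun y ↦ A y i j) s)
    (hdet : ∀ y ∈ s, (A y).det ≠ 0) (i j : Fin m) :
    ContDiffOn ℝ ∞ (fun y ↦ (A y)⁻¹ i j) s := by
  have h : ContDiffOn ℝ ∞ (fun y ↦ ((A y).det)⁻¹ * (A y).adjugate i j) s := by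
    refine ((contDiffOn_det hA).inv hdet).mul ?_
    simp only [Matrix.adjugate_apply]
    refine contDiffOn_det fun k l ↦ ?_
    by_cases hk : k = j
    · subst hk
      simpa using contDiffOn_const
    · simpa [Matrix.updateRow_ne hk] using hA k l
  refine h.congr fun y _ ↦ ?_
  simp [Matrix.inv_def]

variable {g : Metric m M} {e : OpenPartialHomeomorph M (EuclideanSpace ℝ (Fin m))}

theorem contDiffOn_inv_metricMatrix (g : Metric m M)
    (he : e ∈ IsManifold.maximalAtlas (𝓡 m) ∞ M) (i j : Fin m) :
    ContDiffOn ℝ ∞ (fun y ↦ (metricMatrix g e y)⁻¹ i j) e.target :=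
  contDiffOn_inv (contDiffOn_metricMatrix g he) (fun _ hy ↦ (posDef_metricMatrix g he hy).det_pos.ne')
    i j

theorem contDiffOn_sqrt_det_metricMatrix (g : Metric m M)
    (he : e ∈ IsManifold.maximalAtlas (𝓡 m) ∞ M) :
    ContDiffOn ℝ ∞ (fun y ↦ √(metricMatrix g e y).det) e.target :=
  (contDiffOn_det (contDiffOn_metricMatrix g he)).sqrt
    fun _ hy ↦ (posDef_metricMatrix g he hy).det_pos.ne'

theorem contDiffOn_comp_symm (he : e ∈ IsManifold.maximalAtlas (𝓡 m) ∞ M) {φ : M → ℂ}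
    (hφ : ContMDiff (𝓡 m) 𝓘(ℝ, ℂ) ∞ φ) : ContDiffOn ℝ ∞ (fun y ↦ φ (e.symm y)) e.target :=
  contMDiffOn_iff_contDiffOn.1 (hφ.comp_contMDiffOn (contMDiffOn_symm_of_mem_maximalAtlas he))

theorem contDiffOn_chartDeriv (he : e ∈ IsManifold.maximalAtlas (𝓡 m) ∞ M) {φ : M → ℂ}
    (hφ : ContMDiff (𝓡 m) 𝓘(ℝ, ℂ) ∞ φ) (i : Fin m) :
    ContDiffOn ℝ ∞ (chartDeriv e φ i) e.target :=
  ((contDiffOn_comp_symm he hφ).fderiv_of_isOpen e.open_target (by simp)).clm_apply contDiffOn_const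

theorem chartDeriv_sum (he : e ∈ IsManifold.maximalAtlas (𝓡 m) ∞ M) {ι : Type*} (s : Finset ι)
    {φ : ι → M → ℂ} (hφ : ∀ k, ContMDiff (𝓡 m) 𝓘(ℝ, ℂ) ∞ (φ k)) (i : Fin m)
    {y : EuclideanSpace ℝ (Fin m)} (hy : y ∈ e.target) :
    chartDeriv e (fun x ↦ ∑ k ∈ s, φ k x) i y = ∑ k ∈ s, chartDeriv e (φ k) i y := by
  unfold chartDeriv
  rw [fderiv_fun_sum fun k _ ↦ ((contDiffOn_comp_symm he (hφ k)).contDiffAt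
    (e.open_target.mem_nhds hy)).differentiableAt (by simp)]
  simp

theorem chart_mem (x : M) :
    chartAt (EuclideanSpace ℝ (Fin m)) x ∈ IsManifold.maximalAtlas (𝓡 m) ∞ M :=
  IsManifold.chart_mem_maximalAtlas x

theorem conformality_apply (g : Metric m M) (he : e ∈ IsManifold.maximalAtlas (𝓡 m) ∞ M)
    {φ ψ : M → ℂ} (hφ : ContMDiff (𝓡 m) 𝓘(ℝ, ℂ) ∞ φ) (hψ : ContMDiff (𝓡 m) 𝓘(ℝ, ℂ) ∞ ψ)
    {x : M} (hx : x ∈ e.source) :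
    conformality g φ ψ x =
      ∑ i, ∑ j, ((metricMatrix g e (e x))⁻¹ i j : ℂ) *
        (chartDeriv e φ i (e x) * chartDeriv e ψ j (e x)) := by
  rw [← conformality_symm_apply g he hφ hψ (e.map_source hx), e.left_inv hx]

theorem continuous_conformality (g : Metric m M) {φ ψ : M → ℂ}
    (hφ : ContMDiff (𝓡 m) 𝓘(ℝ, ℂ) ∞ φ) (hψ : ContMDiff (𝓡 m) 𝓘(ℝ, ℂ) ∞ ψ) :
    Continuous (conformality g φ ψ) := by
  rw [continuous_iff_continuousAt]
  intro x
  set e := chartAt (EuclideanSpace ℝ (Fin m)) x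
  have he : e ∈ IsManifold.maximalAtlas (𝓡 m) ∞ M := chart_mem x
  have h : ContinuousOn (fun y ↦ ∑ i, ∑ j, ((metricMatrix g e y)⁻¹ i j : ℂ) *
        (chartDeriv e φ i y * chartDeriv e ψ j y)) e.target :=
    continuousOn_finsetSum _ fun i _ ↦ continuousOn_finsetSum _ fun j _ ↦
      (Complex.continuous_ofReal.comp_continuousOn
        (contDiffOn_inv_metricMatrix g he i j).continuousOn).mul
      ((contDiffOn_chartDeriv he hφ i).continuousOn.mul
        (contDiffOn_chartDeriv he hψ j).continuousOn)
  have h2 := h.comp e.continuousOn e.mapsTo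
  refine (h2.congr fun z hz ↦ ?_).continuousAt
    (e.open_source.mem_nhds (mem_chart_source (EuclideanSpace ℝ (Fin m)) x))
  exact conformality_apply g he hφ hψ hz

theorem conformality_sum_right (g : Metric m M) {ι : Type*} (s : Finset ι) {φ : M → ℂ}
    {ψ : ι → M → ℂ} (hφ : ContMDiff (𝓡 m) 𝓘(ℝ, ℂ) ∞ φ)
    (hψ : ∀ k, ContMDiff (𝓡 m) 𝓘(ℝ, ℂ) ∞ (ψ k)) (x : M) :
    conformality g φ (fun z ↦ ∑ k ∈ s, ψ k z) x = ∑ k ∈ s, conformality g φ (ψ k) x := by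
  have hx := mem_chart_source (EuclideanSpace ℝ (Fin m)) x
  rw [conformality_apply g (chart_mem x) hφ (contMDiff_finsetSum fun k _ ↦ hψ k) hx]
  simp only [fun k ↦ conformality_apply g (chart_mem x) hφ (hψ k) hx,
    chartDeriv_sum (chart_mem x) s hψ _ ((chartAt (EuclideanSpace ℝ (Fin m)) x).map_source hx),
    Finset.mul_sum]
  exact (Finset.sum_congr rfl fun i _ ↦ Finset.sum_comm).trans Finset.sum_comm

end Smoothness

/-! ### Transformation of the volume density under a change of chart -/

section ChangeOfChart

variable {g : Metric m M} {e e' : OpenPartialHomeomorph M (EuclideanSpace ℝ (Fin m))}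

/-- All tangent spaces are definitionally the model space, so the same vectors make sense at two
propositionally equal base points. -/
theorem inner_congr (g : Metric m M) {x x' : M} (h : x = x') (v w : EuclideanSpace ℝ (Fin m)) :
    g.inner x (v : TangentSpace (𝓡 m) x) (w : TangentSpace (𝓡 m) x) =
      g.inner x' (v : TangentSpace (𝓡 m) x') (w : TangentSpace (𝓡 m) x') := by
  subst h; rfl

theorem hasFDerivAt_transition (he : e ∈ IsManifold.maximalAtlas (𝓡 m) ∞ M)
    (he' : e' ∈ IsManifold.maximalAtlas (𝓡 m) ∞ M) {y : EuclideanSpace ℝ (Fin m)}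
    (hy : y ∈ (e.symm.trans e').source) :
    HasFDerivAt (e.symm.trans e') (fderiv ℝ (e.symm.trans e') y) y := by
  have h1 := mdifferentiableAt_symm he (y := y) hy.1
  have h2 : MDifferentiableAt (𝓡 m) (𝓡 m) e' (e.symm y) :=
    (mdifferentiable_of_mem_maximalAtlas he').mdifferentiableAt hy.2
  exact (h2.comp y h1).differentiableAt.hasFDerivAt

/-- Chain rule for `e.symm = e'.symm ∘ τ` near `y`, with `τ` the transition map. -/
theorem mfderiv_symm_eq (he : e ∈ IsManifold.maximalAtlas (𝓡 m) ∞ M)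
    (he' : e' ∈ IsManifold.maximalAtlas (𝓡 m) ∞ M) {y : EuclideanSpace ℝ (Fin m)}
    (hy : y ∈ (e.symm.trans e').source) (v : EuclideanSpace ℝ (Fin m)) :
    (mfderiv (𝓡 m) (𝓡 m) e.symm y v : EuclideanSpace ℝ (Fin m)) =
      mfderiv (𝓡 m) (𝓡 m) e'.symm (e.symm.trans e' y) (fderiv ℝ (e.symm.trans e') y v) := by
  have h1 : MDifferentiableAt (𝓡 m) (𝓡 m) (e.symm.trans e') y :=
    (hasFDerivAt_transition he he' hy).differentiableAt.mdifferentiableAt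
  have h2 := mdifferentiableAt_symm he' (y := e.symm.trans e' y)
    ((e.symm.trans e').map_source hy).1
  have h3 : e.symm =ᶠ[nhds y] e'.symm ∘ (e.symm.trans e') := by
    filter_upwards [(e.symm.trans e').open_source.mem_nhds hy] with z hz
    exact (e'.left_inv hz.2).symm
  rw [h3.mfderiv_eq, mfderiv_comp y h2 h1, ← mfderiv_eq_fderiv]
  rfl

theorem metricMatrix_eq (g : Metric m M) (he : e ∈ IsManifold.maximalAtlas (𝓡 m) ∞ M)
    (he' : e' ∈ IsManifold.maximalAtlas (𝓡 m) ∞ M) {y : EuclideanSpace ℝ (Fin m)}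
    (hy : y ∈ (e.symm.trans e').source) :
    metricMatrix g e y =
      (LinearMap.toMatrix (EuclideanSpace.basisFun (Fin m) ℝ).toBasis
        (EuclideanSpace.basisFun (Fin m) ℝ).toBasis
        (fderiv ℝ (e.symm.trans e') y).toLinearMap).transpose *
      metricMatrix g e' (e.symm.trans e' y) *
      LinearMap.toMatrix (EuclideanSpace.basisFun (Fin m) ℝ).toBasis
        (EuclideanSpace.basisFun (Fin m) ℝ).toBasis
        (fderiv ℝ (e.symm.trans e') y).toLinearMap := by
  set J := fderiv ℝ (e.symm.trans e') y with hJ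
  ext i j
  have h1 : metricMatrix g e y i j = metricForm g (e'.symm (e.symm.trans e' y))
      (mfderiv (𝓡 m) (𝓡 m) e'.symm (e.symm.trans e' y) (J (EuclideanSpace.single i 1)))
      (mfderiv (𝓡 m) (𝓡 m) e'.symm (e.symm.trans e' y) (J (EuclideanSpace.single j 1))) := by
    rw [hJ, ← mfderiv_symm_eq he he' hy, ← mfderiv_symm_eq he he' hy]
    exact inner_congr g (e'.left_inv hy.2).symm _ _
  rw [h1]
  have h2 := dotProduct_metricMatrix_mulVec (g := g) (e := e')
    (WithLp.ofLp (J (EuclideanSpace.single i 1))) (WithLp.ofLp (J (EuclideanSpace.single j 1)))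
    (e.symm.trans e' y)
  rw [sum_smul_coordVector, sum_smul_coordVector] at h2
  refine h2.symm.trans ?_
  rw [Matrix.mul_assoc, Matrix.mul_apply_eq_vecMul]
  simp [dotProduct, Matrix.vecMul, Matrix.mul_apply, Matrix.mulVec, LinearMap.toMatrix_apply]

/-- The Gram matrices are related by `G = Jᵀ G' J`. The factor `|det J|` is the one in the change of
variables formula, which makes the Riemannian volume independent of the chart. -/
theorem sqrt_det_metricMatrix (g : Metric m M) (he : e ∈ IsManifold.maximalAtlas (𝓡 m) ∞ M)
    (he' : e' ∈ IsManifold.maximalAtlas (𝓡 m) ∞ M) {y : EuclideanSpace ℝ (Fin m)}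
    (hy : y ∈ (e.symm.trans e').source) :
    √(metricMatrix g e y).det = |(fderiv ℝ (e.symm.trans e') y).det| *
      √(metricMatrix g e' (e.symm.trans e' y)).det := by
  rw [metricMatrix_eq g he he' hy, Matrix.det_mul, Matrix.det_mul, Matrix.det_transpose,
    LinearMap.det_toMatrix, mul_right_comm, ← sq, Real.sqrt_mul (sq_nonneg _), Real.sqrt_sq_eq_abs]

end ChangeOfChart

/-! ### Integration and Green's formula in one chart -/

section Integration

theorem integrableOn_of_eq_zero_off_compact {V : Type*} [TopologicalSpace V] [T2Space V]
    [MeasurableSpace V] [OpensMeasurableSpace V] {μ : Measure V} [IsFiniteMeasureOnCompacts μ]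
    {U K : Set V} (hU : IsOpen U)
    (hK : IsCompact K) (hKU : K ⊆ U) {a : V → ℂ} (ha : ContinuousOn a U)
    (h0 : ∀ y ∈ U \ K, a y = 0) : IntegrableOn a U μ :=
  ((ha.mono hKU).integrableOn_compact hK).of_forall_sdiff_eq_zero hU.measurableSet h0

/-- Extending `p` by zero gives a function differentiable on the whole space, because `p` vanishes
off a compact subset of `U`. Nothing is asked of `W` outside `U`. -/
theorem setIntegral_mul_fderiv_eq_neg {V : Type*} [NormedAddCommGroup V] [NormedSpace ℝ V]
    [FiniteDimensional ℝ V] [MeasurableSpace V] [BorelSpace V] (μ : Measure V)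
    [μ.IsAddHaarMeasure] {U K : Set V} (hU : IsOpen U) (hK : IsCompact K) (hKU : K ⊆ U)
    {p W : V → ℂ} (hp : ContDiffOn ℝ ∞ p U) (hW : ContDiffOn ℝ ∞ W U)
    (h0 : ∀ y ∈ U \ K, p y = 0) (v : V) :
    ∫ y in U, p y * fderiv ℝ W y v ∂μ = -∫ y in U, fderiv ℝ p y v * W y ∂μ := by
  set P : V → ℂ := U.indicator p with hP
  have hPK : ∀ y ∉ K, P =ᶠ[nhds y] fun _ ↦ 0 := fun y hy ↦ by
    filter_upwards [hK.isClosed.isOpen_compl.mem_nhds hy] with z hz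
    by_cases hzU : z ∈ U
    · rw [hP, Set.indicator_of_mem hzU, h0 z ⟨hzU, hz⟩]
    · rw [hP, Set.indicator_of_notMem hzU]
  have hPU : ∀ y ∈ U, P =ᶠ[nhds y] p := fun y hy ↦ by
    filter_upwards [hU.mem_nhds hy] with z hz
    rw [hP, Set.indicator_of_mem hz]
  have hfd : ∀ y, fderiv ℝ P y = U.indicator (fderiv ℝ p) y := fun y ↦ by
    by_cases hy : y ∈ U
    · rw [Set.indicator_of_mem hy, (hPU y hy).fderiv_eq]
    · rw [Set.indicator_of_notMem hy, (hPK y fun h ↦ hy (hKU h)).fderiv_eq]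
      simp
  have hPd : Differentiable ℝ P := fun y ↦ by
    by_cases hy : y ∈ U
    · exact (hPU y hy).differentiableAt_iff.2
        ((hp.contDiffAt (hU.mem_nhds hy)).differentiableAt (by simp))
    · exact (hPK y fun h ↦ hy (hKU h)).differentiableAt_iff.2 (differentiableAt_const _)
  have hts : tsupport P ⊆ K := closure_minimal (fun y hy ↦ by
    by_contra h
    exact hy (hPK y h).eq_of_nhds) hK.isClosed
  have hpd0 : ∀ y ∈ U \ K, fderiv ℝ p y = 0 := fun y hy ↦ by
    rw [← (hPU y hy.1).fderiv_eq, (hPK y hy.2).fderiv_eq]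
    simp
  have hfW : ContinuousOn (fun y ↦ fderiv ℝ W y v) U :=
    (hW.continuousOn_fderiv_of_isOpen hU (by simp)).clm_apply continuousOn_const
  have hfp : ContinuousOn (fun y ↦ fderiv ℝ p y v) U :=
    (hp.continuousOn_fderiv_of_isOpen hU (by simp)).clm_apply continuousOn_const
  have e1 : (fun y ↦ P y * fderiv ℝ W y v) = U.indicator fun y ↦ p y * fderiv ℝ W y v := by
    ext y; by_cases hy : y ∈ U <;> simp [hP, hy]
  have e2 : (fun y ↦ fderiv ℝ P y v * W y) = U.indicator fun y ↦ fderiv ℝ p y v * W y := by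
    ext y; rw [hfd]; by_cases hy : y ∈ U <;> simp [hy]
  have e3 : (fun y ↦ P y * W y) = U.indicator fun y ↦ p y * W y := by
    ext y; by_cases hy : y ∈ U <;> simp [hP, hy]
  -- Differentiability of `W` is required only on the topological support of `P`, which lies in `K ⊆
  -- U`.
  have key := integral_mul_fderiv_eq_neg_fderiv_mul_of_integrable (μ := μ) (f := P) (g := W)
    (v := v) ?_ ?_ ?_ (fun y _ ↦ hPd y) (fun y hy ↦ (hW.contDiffAt
      (hU.mem_nhds (hKU (hts hy)))).differentiableAt (by simp))
  · rwa [e1, e2, integral_indicator hU.measurableSet, integral_indicator hU.measurableSet] at key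
  · rw [e2, integrable_indicator_iff hU.measurableSet]
    exact integrableOn_of_eq_zero_off_compact hU hK hKU (hfp.mul hW.continuousOn)
      fun y hy ↦ by simp [hpd0 y hy]
  · rw [e1, integrable_indicator_iff hU.measurableSet]
    exact integrableOn_of_eq_zero_off_compact hU hK hKU (hp.continuousOn.mul hfW)
      fun y hy ↦ by simp [h0 y hy]
  · rw [e3, integrable_indicator_iff hU.measurableSet]
    exact integrableOn_of_eq_zero_off_compact hU hK hKU (hp.continuousOn.mul hW.continuousOn)
      fun y hy ↦ by simp [h0 y hy]

/-- The integral of `h` over the domain of a chart `e` with respect to the Riemannian volume. -/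
def chartIntegral (g : Metric m M) (e : OpenPartialHomeomorph M (EuclideanSpace ℝ (Fin m)))
    (h : M → ℂ) : ℂ :=
  ∫ y in e.target, ((√(metricMatrix g e y).det : ℝ) : ℂ) * h (e.symm y)

variable {g : Metric m M} {e e' : OpenPartialHomeomorph M (EuclideanSpace ℝ (Fin m))}

theorem chartIntegral_change_chart (g : Metric m M)
    (he : e ∈ IsManifold.maximalAtlas (𝓡 m) ∞ M) (he' : e' ∈ IsManifold.maximalAtlas (𝓡 m) ∞ M)
    {h : M → ℂ} (h0 : ∀ x, h x ≠ 0 → x ∈ e.source) (h0' : ∀ x, h x ≠ 0 → x ∈ e'.source) :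
    chartIntegral g e h = chartIntegral g e' h := by
  set τ := e.symm.trans e' with hτ
  have h1 : chartIntegral g e h =
      ∫ y in τ.source, ((√(metricMatrix g e y).det : ℝ) : ℂ) * h (e.symm y) := by
    refine setIntegral_eq_of_subset_of_forall_sdiff_eq_zero e.open_target.measurableSet
      (fun y hy ↦ hy.1) fun y hy ↦ ?_
    by_contra hne
    exact hy.2 ⟨hy.1, h0' _ (right_ne_zero_of_mul hne)⟩
  have h2 : chartIntegral g e' h =
      ∫ y in τ.target, ((√(metricMatrix g e' y).det : ℝ) : ℂ) * h (e'.symm y) := by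
    refine setIntegral_eq_of_subset_of_forall_sdiff_eq_zero e'.open_target.measurableSet
      (fun y hy ↦ hy.1) fun y hy ↦ ?_
    by_contra hne
    exact hy.2 ⟨hy.1, h0 _ (right_ne_zero_of_mul hne)⟩
  rw [h1, h2, ← τ.image_source_eq_target, integral_image_eq_integral_abs_det_fderiv_smul volume
    τ.open_source.measurableSet
    (fun y hy ↦ (hasFDerivAt_transition he he' hy).hasFDerivWithinAt) τ.injOn]
  refine setIntegral_congr_fun τ.open_source.measurableSet fun y hy ↦ ?_
  have h3 : e'.symm (e.symm.trans e' y) = e.symm y := e'.left_inv hy.2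
  simp only [sqrt_det_metricMatrix g he he' hy, Complex.real_smul]
  rw [h3]
  push_cast
  ring

variable [T2Space M] [CompactSpace M]

theorem isCompact_image_tsupport {h : M → ℂ} (hs : tsupport h ⊆ e.source) :
    IsCompact (e '' tsupport h) :=
  (isClosed_tsupport h).isCompact.image_of_continuousOn (e.continuousOn.mono hs)

theorem image_tsupport_subset {h : M → ℂ} (hs : tsupport h ⊆ e.source) :
    e '' tsupport h ⊆ e.target := by
  rintro _ ⟨x, hx, rfl⟩
  exact e.map_source (hs hx)

theorem symm_notMem_tsupport {h : M → ℂ} {y : EuclideanSpace ℝ (Fin m)}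
    (hy : y ∈ e.target \ e '' tsupport h) : e.symm y ∉ tsupport h :=
  fun hx ↦ hy.2 ⟨_, hx, e.right_inv hy.1⟩

theorem integrableOn_chart (g : Metric m M) (he : e ∈ IsManifold.maximalAtlas (𝓡 m) ∞ M)
    {h : M → ℂ} (hc : Continuous h) (hs : tsupport h ⊆ e.source) :
    IntegrableOn (fun y ↦ ((√(metricMatrix g e y).det : ℝ) : ℂ) * h (e.symm y)) e.target := by
  refine integrableOn_of_eq_zero_off_compact e.open_target (isCompact_image_tsupport hs)
    (image_tsupport_subset hs) ?_ fun y hy ↦ ?_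
  · exact (Complex.continuous_ofReal.comp_continuousOn
      (contDiffOn_sqrt_det_metricMatrix g he).continuousOn).mul
      (hc.comp_continuousOn e.symm.continuousOn)
  · rw [image_eq_zero_of_notMem_tsupport (symm_notMem_tsupport hy), mul_zero]

theorem chartIntegral_sum (g : Metric m M) (he : e ∈ IsManifold.maximalAtlas (𝓡 m) ∞ M)
    {ι : Type*} (s : Finset ι) {h : ι → M → ℂ} (hc : ∀ i, Continuous (h i))
    (hs : ∀ i, tsupport (h i) ⊆ e.source) :
    chartIntegral g e (fun x ↦ ∑ i ∈ s, h i x) = ∑ i ∈ s, chartIntegral g e (h i) := by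
  unfold chartIntegral
  rw [← integral_finsetSum _ fun i _ ↦ integrableOn_chart g he (hc i) (hs i)]
  simp only [Finset.mul_sum]

/-- Green's formula for a test function supported in the domain of a chart. -/
theorem chartIntegral_mul_laplacian (g : Metric m M)
    (he : e ∈ IsManifold.maximalAtlas (𝓡 m) ∞ M) {φ ψ η : M → ℂ}
    (hφ : ContMDiff (𝓡 m) 𝓘(ℝ, ℂ) ∞ φ) (hψ : ContMDiff (𝓡 m) 𝓘(ℝ, ℂ) ∞ ψ)
    (hη : LaplaceBeltramiEq g φ η) (hs : tsupport ψ ⊆ e.source) :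
    chartIntegral g e (fun x ↦ ψ x * η x) = -chartIntegral g e (conformality g φ ψ) := by
  set K := e '' tsupport ψ
  have hK := isCompact_image_tsupport hs
  have hKU := image_tsupport_subset hs
  set p : EuclideanSpace ℝ (Fin m) → ℂ := fun y ↦ ψ (e.symm y) with hpdef
  have hp : ContDiffOn ℝ ∞ p e.target := contDiffOn_comp_symm he hψ
  have hp0 : ∀ y ∈ e.target \ K, p y = 0 := fun y hy ↦
    image_eq_zero_of_notMem_tsupport (f := ψ) (symm_notMem_tsupport hy)
  have hdp0 (j : Fin m) : ∀ y ∈ e.target \ K, chartDeriv e ψ j y = 0 := fun y hy ↦ by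
    have : p =ᶠ[nhds y] fun _ ↦ 0 := by
      filter_upwards [(e.open_target.sdiff hK.isClosed).mem_nhds hy] with z hz using hp0 z hz
    simp [chartDeriv, ← hpdef, this.fderiv_eq]
  -- The quantities under the divergence: `√|g| Δφ = ∑ ∂ⱼ (W i j)`, so the density cancels the
  -- factor `1/√|g|` and each summand can be integrated by parts.
  set W : Fin m → Fin m → EuclideanSpace ℝ (Fin m) → ℂ := fun i j y ↦
    (((metricMatrix g e y)⁻¹ i j * √((metricMatrix g e y).det) : ℝ) : ℂ) * chartDeriv e φ i y
    with hWdef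
  have hW (i j : Fin m) : ContDiffOn ℝ ∞ (W i j) e.target :=
    (Complex.ofRealCLM.contDiff.comp_contDiffOn ((contDiffOn_inv_metricMatrix g he i j).mul
      (contDiffOn_sqrt_det_metricMatrix g he))).mul (contDiffOn_chartDeriv he hφ i)
  have hfW (i j : Fin m) : ContinuousOn
      (fun y ↦ fderiv ℝ (W i j) y (EuclideanSpace.single j 1)) e.target :=
    ((hW i j).continuousOn_fderiv_of_isOpen e.open_target (by simp)).clm_apply continuousOn_const
  have hleft : chartIntegral g e (fun x ↦ ψ x * η x) = ∑ i, ∑ j,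
      ∫ y in e.target, p y * fderiv ℝ (W i j) y (EuclideanSpace.single j 1) := by
    have hint (i j : Fin m) : IntegrableOn
        (fun y ↦ p y * fderiv ℝ (W i j) y (EuclideanSpace.single j 1)) e.target :=
      integrableOn_of_eq_zero_off_compact e.open_target hK hKU (hp.continuousOn.mul (hfW i j))
        fun y hy ↦ by simp [hp0 y hy]
    simp_rw [← integral_finsetSum _ fun j _ ↦ hint _ j]
    rw [← integral_finsetSum _ fun i _ ↦ integrable_finsetSum _ fun j _ ↦ hint i j]
    refine setIntegral_congr_fun e.open_target.measurableSet fun y hy ↦ ?_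
    have h1 := hη e he (e.symm y) (e.map_target hy)
    simp only [laplacianInChart, e.right_inv hy] at h1
    have hd : ((√((metricMatrix g e y).det) : ℝ) : ℂ) ≠ 0 :=
      Complex.ofReal_ne_zero.2 (Real.sqrt_pos.2 (posDef_metricMatrix g he hy).det_pos).ne'
    simp only [← h1, Finset.mul_sum]
    refine Finset.sum_congr rfl fun i _ ↦ Finset.sum_congr rfl fun j _ ↦ ?_
    change _ * (p y * (_ * fderiv ℝ (W i j) y _)) = _
    push_cast
    field_simp
  have hright : chartIntegral g e (conformality g φ ψ) = ∑ i, ∑ j,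
      ∫ y in e.target, fderiv ℝ p y (EuclideanSpace.single j 1) * W i j y := by
    have hint (i j : Fin m) : IntegrableOn
        (fun y ↦ fderiv ℝ p y (EuclideanSpace.single j 1) * W i j y) e.target :=
      integrableOn_of_eq_zero_off_compact e.open_target hK hKU
        ((contDiffOn_chartDeriv he hψ j).continuousOn.mul (hW i j).continuousOn)
        fun y hy ↦ by
          have := hdp0 j y hy
          simp only [chartDeriv] at this
          simp [hpdef, this]
    simp_rw [← integral_finsetSum _ fun j _ ↦ hint _ j]
    rw [← integral_finsetSum _ fun i _ ↦ integrable_finsetSum _ fun j _ ↦ hint i j]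
    refine setIntegral_congr_fun e.open_target.measurableSet fun y hy ↦ ?_
    simp only [conformality_symm_apply g he hφ hψ hy, Finset.mul_sum]
    refine Finset.sum_congr rfl fun i _ ↦ Finset.sum_congr rfl fun j _ ↦ ?_
    change _ = chartDeriv e ψ j y * _
    simp only [hWdef]
    push_cast
    ring
  rw [hleft, hright, ← Finset.sum_neg_distrib]
  refine Finset.sum_congr rfl fun i _ ↦ ?_
  rw [← Finset.sum_neg_distrib]
  exact Finset.sum_congr rfl fun j _ ↦
    setIntegral_mul_fderiv_eq_neg volume e.open_target hK hKU hp (hW i j) hp0 _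

end Integration

/-! ### The integral over the manifold and the global Green formula -/

section GlobalIntegration

variable (m M) in
/-- A finite smooth partition of unity, subordinate to the domains of charts. -/
structure ChartPartition where
  centers : Finset M
  weight : centers → M → ℝ
  contMDiff_weight : ∀ i, ContMDiff (𝓡 m) 𝓘(ℝ, ℝ) ∞ (weight i)
  weight_nonneg : ∀ i x, 0 ≤ weight i x
  sum_weight : ∀ x, ∑ i, weight i x = 1
  tsupport_weight_subset : ∀ i,
    tsupport (weight i) ⊆ (chartAt (EuclideanSpace ℝ (Fin m)) (i : M)).source

namespace ChartPartition

variable (P : ChartPartition m M)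

theorem contMDiff_ofReal_weight (i : P.centers) :
    ContMDiff (𝓡 m) 𝓘(ℝ, ℂ) ∞ (fun x ↦ (P.weight i x : ℂ)) :=
  (Complex.ofRealCLM.contDiff.contMDiff (n := ∞)).comp (P.contMDiff_weight i)

theorem tsupport_weight_mul_subset (i : P.centers) (h : M → ℂ) :
    tsupport (fun x ↦ (P.weight i x : ℂ) * h x) ⊆
      (chartAt (EuclideanSpace ℝ (Fin m)) (i : M)).source := by
  refine (closure_mono fun x hx ↦ ?_).trans (P.tsupport_weight_subset i)
  exact Complex.ofReal_ne_zero.1 (left_ne_zero_of_mul hx)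

theorem sum_weight_mul (h : M → ℂ) (x : M) : ∑ i, (P.weight i x : ℂ) * h x = h x := by
  rw [← Finset.sum_mul, ← Complex.ofReal_sum, P.sum_weight, Complex.ofReal_one, one_mul]

/-- The integral over `M` with respect to the Riemannian volume. -/
def integral (g : Metric m M) (h : M → ℂ) : ℂ :=
  ∑ i : P.centers, chartIntegral g (chartAt (EuclideanSpace ℝ (Fin m)) (i : M))
    (fun x ↦ (P.weight i x : ℂ) * h x)

end ChartPartition

variable {g : Metric m M} {e : OpenPartialHomeomorph M (EuclideanSpace ℝ (Fin m))}
variable [T2Space M] [CompactSpace M]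

theorem nonempty_chartPartition : Nonempty (ChartPartition m M) := by
  obtain ⟨t, -, ht⟩ := isCompact_univ.elim_nhds_subcover
    (fun x : M ↦ (chartAt (EuclideanSpace ℝ (Fin m)) x).source)
    (fun x _ ↦ chart_source_mem_nhds _ x)
  obtain ⟨ρ, hρ⟩ := SmoothPartitionOfUnity.exists_isSubordinate (𝓡 m) (s := Set.univ)
    isClosed_univ (fun i : t ↦ (chartAt (EuclideanSpace ℝ (Fin m)) (i : M)).source)
    (fun i ↦ OpenPartialHomeomorph.open_source _) (fun x hx ↦ by
      simpa using ht hx)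
  exact ⟨{
    centers := t
    weight := fun i ↦ ρ i
    contMDiff_weight := fun i ↦ (ρ i).contMDiff
    weight_nonneg := fun i x ↦ ρ.nonneg i x
    sum_weight := fun x ↦ by
      rw [← finsum_eq_sum_of_fintype]
      exact ρ.sum_eq_one (Set.mem_univ x)
    tsupport_weight_subset := hρ }⟩

namespace ChartPartition

variable (P : ChartPartition m M)

theorem integral_sum {ι : Type*} (s : Finset ι) {h : ι → M → ℂ} (hc : ∀ k, Continuous (h k)) :
    P.integral g (fun x ↦ ∑ k ∈ s, h k x) = ∑ k ∈ s, P.integral g (h k) := by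
  unfold integral
  rw [Finset.sum_comm]
  refine Finset.sum_congr rfl fun i _ ↦ ?_
  simp only [Finset.mul_sum]
  exact chartIntegral_sum g (chart_mem _) s
    (fun k ↦ (P.contMDiff_ofReal_weight i).continuous.mul (hc k))
    fun k ↦ P.tsupport_weight_mul_subset i _

/-- Cut `h` by the partition of unity; each piece is supported in both `e` and a chart of the
partition, where the two chart integrals agree. -/
theorem chartIntegral_eq_integral (he : e ∈ IsManifold.maximalAtlas (𝓡 m) ∞ M) {h : M → ℂ}
    (hc : Continuous h) (hs : tsupport h ⊆ e.source) : chartIntegral g e h = P.integral g h := by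
  have h1 : chartIntegral g e h = chartIntegral g e fun x ↦ ∑ i, (P.weight i x : ℂ) * h x := by
    simp only [P.sum_weight_mul]
  rw [h1, chartIntegral_sum (h := fun i x ↦ (P.weight i x : ℂ) * h x) g he _
    (fun i ↦ (P.contMDiff_ofReal_weight i).continuous.mul hc)
    fun i ↦ (closure_mono fun x hx ↦ right_ne_zero_of_mul hx).trans hs]
  refine Finset.sum_congr rfl fun i _ ↦ chartIntegral_change_chart g he (chart_mem _) ?_ ?_
  · exact fun x hx ↦ hs (subset_tsupport _ (right_ne_zero_of_mul hx))
  · exact fun x hx ↦ P.tsupport_weight_mul_subset i h (subset_tsupport _ hx)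

/-- Green's formula on a compact manifold. -/
theorem integral_mul_laplacian {φ ψ η : M → ℂ} (hφ : ContMDiff (𝓡 m) 𝓘(ℝ, ℂ) ∞ φ)
    (hψ : ContMDiff (𝓡 m) 𝓘(ℝ, ℂ) ∞ ψ) (hη : LaplaceBeltramiEq g φ η) :
    P.integral g (fun x ↦ ψ x * η x) = -P.integral g (conformality g φ ψ) := by
  have hρψ (i : P.centers) : ContMDiff (𝓡 m) 𝓘(ℝ, ℂ) ∞ fun x ↦ (P.weight i x : ℂ) * ψ x := by
    have h := (P.contMDiff_weight i).smul hψ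
    rwa [show P.weight i • ψ = fun x ↦ (P.weight i x : ℂ) * ψ x from
      funext fun _ ↦ Complex.real_smul] at h
  -- Off the support of the weighted test function its derivatives vanish, and so does its
  -- conformality with `φ`.
  have hsupp (i : P.centers) : tsupport (conformality g φ fun x ↦ (P.weight i x : ℂ) * ψ x) ⊆
      (chartAt (EuclideanSpace ℝ (Fin m)) (i : M)).source := by
    refine subset_trans ?_ (P.tsupport_weight_mul_subset i ψ)
    refine closure_minimal (fun x hx ↦ ?_) (isClosed_tsupport _)
    by_contra hx'
    refine hx ?_
    have h0 := notMem_tsupport_iff_eventuallyEq.1 hx'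
    set e := chartAt (EuclideanSpace ℝ (Fin m)) x
    have hxe : x ∈ e.source := mem_chart_source _ x
    have h1 : (fun z ↦ (P.weight i (e.symm z) : ℂ) * ψ (e.symm z)) =ᶠ[nhds (e x)] fun _ ↦ 0 := by
      have := e.continuousAt_symm (e.map_source hxe)
      rw [ContinuousAt, e.left_inv hxe] at this
      exact this.eventually h0
    rw [conformality_apply g (chart_mem x) hφ (hρψ i) hxe]
    refine Finset.sum_eq_zero fun k _ ↦ Finset.sum_eq_zero fun l _ ↦ ?_
    have : chartDeriv e (fun x ↦ (P.weight i x : ℂ) * ψ x) l (e x) = 0 := by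
      simp [chartDeriv, h1.fderiv_eq]
    rw [this, mul_zero, mul_zero]
  -- Since the weights sum to one, `κ(φ, ψ) = ∑ κ(φ, ρᵢ ψ)`: the weights are put into the test
  -- function, so their derivatives never need separate treatment.
  have h1 : P.integral g (conformality g φ ψ) = P.integral g
      (fun x ↦ ∑ i, conformality g φ (fun z ↦ (P.weight i z : ℂ) * ψ z) x) := by
    congr 1
    funext x
    rw [← conformality_sum_right g _ hφ hρψ]
    simp only [P.sum_weight_mul]
  rw [h1, P.integral_sum _ fun i ↦ continuous_conformality g hφ (hρψ i), integral,
    ← Finset.sum_neg_distrib]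
  refine Finset.sum_congr rfl fun i _ ↦ ?_
  rw [← P.chartIntegral_eq_integral (chart_mem (i : M)) (continuous_conformality g hφ (hρψ i))
    (hsupp i), ← chartIntegral_mul_laplacian g (chart_mem (i : M)) hφ (hρψ i) hη
    (P.tsupport_weight_mul_subset i ψ)]
  simp only [mul_assoc]

theorem integral_const_mul (c : ℂ) (h : M → ℂ) :
    P.integral g (fun x ↦ c * h x) = c * P.integral g h := by
  simp only [integral, chartIntegral, Finset.mul_sum, ← MeasureTheory.integral_const_mul]
  refine Finset.sum_congr rfl fun i _ ↦ ?_
  congr 1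
  funext y
  ring

theorem integral_ofReal (q : M → ℝ) : P.integral g (fun x ↦ (q x : ℂ)) =
    ((∑ i : P.centers, ∫ y in (chartAt (EuclideanSpace ℝ (Fin m)) (i : M)).target,
      √(metricMatrix g (chartAt (EuclideanSpace ℝ (Fin m)) (i : M)) y).det *
        (P.weight i ((chartAt (EuclideanSpace ℝ (Fin m)) (i : M)).symm y) *
          q ((chartAt (EuclideanSpace ℝ (Fin m)) (i : M)).symm y)) : ℝ) : ℂ) := by
  simp only [integral, chartIntegral, Complex.ofReal_sum, ← integral_complex_ofReal,
    Complex.ofReal_mul]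

/-- Every chart contribution is a nonnegative integral, hence zero. A continuous integrand that
vanishes almost everywhere on an open set vanishes there, and the density is positive. -/
theorem eq_zero_of_integral_eq_zero {q : M → ℝ} (hq : Continuous q) (hq0 : ∀ x, 0 ≤ q x)
    (h : P.integral g (fun x ↦ (q x : ℂ)) = 0) (x : M) : q x = 0 := by
  rw [P.integral_ofReal, Complex.ofReal_eq_zero, Finset.sum_eq_zero_iff_of_nonneg] at h
  swap
  · exact fun i _ ↦ setIntegral_nonneg (OpenPartialHomeomorph.open_target _).measurableSet
      fun y _ ↦ mul_nonneg (Real.sqrt_nonneg _) (mul_nonneg (P.weight_nonneg _ _) (hq0 _))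
  have key (i : P.centers) (hx : x ∈ (chartAt (EuclideanSpace ℝ (Fin m)) (i : M)).source) :
      P.weight i x * q x = 0 := by
    have hi := h i (Finset.mem_univ i)
    set e := chartAt (EuclideanSpace ℝ (Fin m)) (i : M)
    have he : e ∈ IsManifold.maximalAtlas (𝓡 m) ∞ M := chart_mem _
    have hint : IntegrableOn (fun y ↦ √(metricMatrix g e y).det *
        (P.weight i (e.symm y) * q (e.symm y))) e.target := by
      have h1 := integrableOn_chart g he (h := fun x ↦ (P.weight i x : ℂ) * (q x : ℂ))
        ((P.contMDiff_ofReal_weight i).continuous.mul (Complex.continuous_ofReal.comp hq))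
        (P.tsupport_weight_mul_subset i _)
      simpa [IntegrableOn] using h1.re
    rw [setIntegral_eq_zero_iff_of_nonneg_ae (Filter.Eventually.of_forall fun y ↦
      mul_nonneg (Real.sqrt_nonneg _) (mul_nonneg (P.weight_nonneg _ _) (hq0 _))) hint] at hi
    have h2 := Measure.eqOn_open_of_ae_eq hi e.open_target
      ((contDiffOn_sqrt_det_metricMatrix g he).continuousOn.mul
        (((P.contMDiff_weight i).continuous.mul hq).comp_continuousOn e.symm.continuousOn))
      continuousOn_const (e.map_source hx)
    simp only [Pi.zero_apply, e.left_inv hx] at h2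
    exact (mul_eq_zero.1 h2).resolve_left
      (Real.sqrt_pos.2 (posDef_metricMatrix g he (e.map_source hx)).det_pos).ne'
  have h3 : ∑ i, P.weight i x * q x = q x := by rw [← Finset.sum_mul, P.sum_weight, one_mul]
  rw [← h3]
  refine Finset.sum_eq_zero fun i _ ↦ ?_
  by_cases hx : x ∈ (chartAt (EuclideanSpace ℝ (Fin m)) (i : M)).source
  · exact key i hx
  · rw [image_eq_zero_of_notMem_tsupport fun h ↦ hx (P.tsupport_weight_subset i h), zero_mul]

end ChartPartition

end GlobalIntegration

/-! ### Reality and nonvanishing of the Laplace eigenvalue -/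

section Consequences

variable {g : Metric m M}

/-- A zero gradient means a zero differential; in a chart this forces constancy on a ball around the
image of each point. -/
theorem isLocallyConstant_of_realGradient_eq_zero {u : M → ℝ}
    (hu : MDifferentiable (𝓡 m) 𝓘(ℝ, ℝ) u) (h : ∀ x, realGradient g u x = 0) :
    IsLocallyConstant u := by
  rw [IsLocallyConstant.iff_eventually_eq]
  intro x
  set e := chartAt (EuclideanSpace ℝ (Fin m)) x
  have he : e ∈ IsManifold.maximalAtlas (𝓡 m) ∞ M := chart_mem _
  have hx : x ∈ e.source := mem_chart_source _ x
  have hd : ∀ y ∈ e.target, HasFDerivAt (u ∘ e.symm) (0 : EuclideanSpace ℝ (Fin m) →L[ℝ] ℝ) y := by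
    intro y hy
    have h0 : mfderiv (𝓡 m) 𝓘(ℝ, ℝ) u (e.symm y) = 0 := by
      ext v
      have := metricForm_realGradient g u (e.symm y) v
      rw [h, map_zero] at this
      exact this.symm
    have h1 := mfderiv_comp y (hu (e.symm y)) (mdifferentiableAt_symm he hy)
    rw [h0, ContinuousLinearMap.zero_comp, mfderiv_eq_fderiv] at h1
    have h2 := ((hu (e.symm y)).comp y (mdifferentiableAt_symm he hy)).differentiableAt.hasFDerivAt
    rwa [h1] at h2
  obtain ⟨r, hr, hball⟩ := Metric.isOpen_iff.1 e.open_target _ (e.map_source hx)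
  have hnear : ∀ᶠ z in nhds x, z ∈ e.source ∧ e z ∈ Metric.ball (e x) r :=
    (e.open_source.eventually_mem hx).and
      ((e.continuousAt hx).eventually (Metric.isOpen_ball.mem_nhds (Metric.mem_ball_self hr)))
  filter_upwards [hnear] with z hz
  have := Metric.isOpen_ball.is_const_of_fderiv_eq_zero
    (convex_ball (e x) r).isPreconnected
    (fun y hy ↦ (hd y (hball hy)).differentiableAt.differentiableWithinAt)
    (fun y hy ↦ (hd y (hball hy)).fderiv) hz.2 (Metric.mem_ball_self hr)
  simpa [e.left_inv hz.1, e.left_inv hx] using this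

/-- The squared norm of the gradient of a complex function. -/
def gradientNormSq (g : Metric m M) (φ : M → ℂ) (x : M) : ℝ :=
  metricForm g x (realGradient g (fun z ↦ (φ z).re) x) (realGradient g (fun z ↦ (φ z).re) x) +
  metricForm g x (realGradient g (fun z ↦ (φ z).im) x) (realGradient g (fun z ↦ (φ z).im) x)

theorem metricForm_self_nonneg (x : M) (v : TangentSpace (𝓡 m) x) : 0 ≤ metricForm g x v v := by
  by_cases h : v = 0
  · simp [h]
  · exact (g.pos x v h).le

theorem metricForm_self_eq_zero {x : M} {v : TangentSpace (𝓡 m) x} (h : metricForm g x v v = 0) :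
    v = 0 := by
  by_contra h0
  exact (g.pos x v h0).ne' h

theorem gradientNormSq_nonneg (φ : M → ℂ) (x : M) : 0 ≤ gradientNormSq g φ x :=
  add_nonneg (metricForm_self_nonneg _ _) (metricForm_self_nonneg _ _)

theorem realGradient_neg (u : M → ℝ) (x : M) :
    realGradient g (fun z ↦ -u z) x = -realGradient g u x := by
  have h1 : mfderiv (𝓡 m) 𝓘(ℝ, ℝ) (fun z ↦ -u z) x = -mfderiv (𝓡 m) 𝓘(ℝ, ℝ) u x :=
    mfderiv_neg
  rw [eq_neg_iff_add_eq_zero]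
  refine (metricForm_nondegenerate g x).1 _ fun w ↦ ?_
  rw [map_add, LinearMap.add_apply, metricForm_realGradient, metricForm_realGradient, h1]
  exact neg_add_cancel _

/-- Conjugation flips the sign of the imaginary gradient, so the squares add up and the mixed terms
cancel by symmetry of the metric. -/
theorem conformality_conj (φ : M → ℂ) (x : M) :
    conformality g φ (fun z ↦ starRingEnd ℂ (φ z)) x = (gradientNormSq g φ x : ℂ) := by
  have hsymm (v w : TangentSpace (𝓡 m) x) : metricForm g x v w = metricForm g x w v :=
    g.symm x v w
  rw [conformality_eq]
  simp only [Complex.conj_re, Complex.conj_im, realGradient_neg, map_neg, gradientNormSq]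
  rw [hsymm (realGradient g (fun z ↦ (φ z).im) x) (realGradient g (fun z ↦ (φ z).re) x)]
  push_cast
  ring

theorem isLocallyConstant_of_gradientNormSq_eq_zero {φ : M → ℂ}
    (hφ : ContMDiff (𝓡 m) 𝓘(ℝ, ℂ) ∞ φ) (h : ∀ x, gradientNormSq g φ x = 0) :
    IsLocallyConstant φ := by
  have h1 (x : M) := (add_eq_zero_iff_of_nonneg (metricForm_self_nonneg _ _)
    (metricForm_self_nonneg _ _)).1 (h x)
  have hre : IsLocallyConstant fun z ↦ (φ z).re := isLocallyConstant_of_realGradient_eq_zero (g := g)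
    (((Complex.reCLM.contDiff.contMDiff (n := ∞)).comp hφ).mdifferentiable (by simp))
    fun x ↦ metricForm_self_eq_zero (h1 x).1
  have him : IsLocallyConstant fun z ↦ (φ z).im := isLocallyConstant_of_realGradient_eq_zero (g := g)
    (((Complex.imCLM.contDiff.contMDiff (n := ∞)).comp hφ).mdifferentiable (by simp))
    fun x ↦ metricForm_self_eq_zero (h1 x).2
  exact hre.comp₂ him Complex.mk

variable [T2Space M] [CompactSpace M]

/-- An eigenvalue of the Laplace-Beltrami operator of a compact manifold is real, and it is nonzero
if the eigenfunction is not locally constant. -/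
theorem laplacian_eigenvalue {lam : ℂ} {f : M → ℂ} (hf : ContMDiff (𝓡 m) 𝓘(ℝ, ℂ) ∞ f)
    (hΔ : LaplaceBeltramiEq g f (fun x ↦ lam * f x)) (hconst : ¬ IsLocallyConstant f) :
    lam.im = 0 ∧ lam ≠ 0 := by
  obtain ⟨P⟩ := nonempty_chartPartition (m := m) (M := M)
  have hconj : ContMDiff (𝓡 m) 𝓘(ℝ, ℂ) ∞ fun z ↦ starRingEnd ℂ (f z) :=
    (Complex.conjCLE.contDiff.contMDiff (n := ∞)).comp hf
  have hgreen := P.integral_mul_laplacian hf hconj hΔ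
  have e1 : (fun x ↦ starRingEnd ℂ (f x) * (lam * f x)) =
      fun x ↦ lam * ((Complex.normSq (f x) : ℝ) : ℂ) := by
    funext x
    rw [Complex.normSq_eq_conj_mul_self]
    ring
  have e2 : conformality g f (fun z ↦ starRingEnd ℂ (f z)) =
      fun x ↦ (gradientNormSq g f x : ℂ) := funext (conformality_conj f)
  have hcont : Continuous (gradientNormSq g f) := by
    have := Complex.continuous_re.comp (continuous_conformality g hf hconj)
    rw [e2] at this
    exact this
  rw [e1, e2, P.integral_const_mul] at hgreen
  have hB : P.integral g (fun x ↦ (gradientNormSq g f x : ℂ)) ≠ 0 := fun h ↦ hconst <|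
    isLocallyConstant_of_gradientNormSq_eq_zero hf
      (P.eq_zero_of_integral_eq_zero hcont (gradientNormSq_nonneg f) h)
  refine ⟨?_, fun h ↦ hB ?_⟩
  -- Here `lam * A = -B` with `A`, `B` real and `B ≠ 0`. Hence `A ≠ 0`, and taking imaginary parts
  -- gives `lam.im * A = 0`.
  · have hA : P.integral g (fun x ↦ ((Complex.normSq (f x) : ℝ) : ℂ)) ≠ 0 := fun h ↦ by
      rw [h, mul_zero] at hgreen
      exact hB (neg_eq_zero.1 hgreen.symm)
    rw [P.integral_ofReal, Complex.ofReal_ne_zero] at hA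
    rw [P.integral_ofReal, P.integral_ofReal] at hgreen
    have := congrArg Complex.im hgreen
    rw [Complex.im_mul_ofReal, Complex.neg_im, Complex.ofReal_im, neg_zero] at this
    exact (mul_eq_zero.1 this).resolve_right hA
  · rw [h, zero_mul] at hgreen
    exact neg_eq_zero.1 hgreen.symm

end Consequences

/-! ### Linear algebra and second-order conditions -/

section Pointwise

/-- The hypothesis says that the quadratic form of the symmetric matrix `H A H` vanishes on real
vectors. Polarization gives `H A H = 0`, so `(A H)² = 0`, and a nilpotent matrix has trace zero. No
definiteness is needed, which matters because `H` is complex. -/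
theorem sum_mul_eq_zero_of_quadratic_eq_zero (A : Matrix (Fin m) (Fin m) ℂ)
    (H : Matrix (Fin m) (Fin m) ℂ) (hA : A.IsSymm) (hH : H.IsSymm)
    (h : ∀ v : Fin m → ℝ, ∑ i, ∑ j, A i j *
      ((∑ k, (v k : ℂ) * H i k) * ∑ k, (v k : ℂ) * H j k) = 0) :
    ∑ i, ∑ j, A i j * H i j = 0 := by
  set Q := H * A * H with hQ
  have hQs : Q.IsSymm := by
    rw [Matrix.IsSymm, hQ, Matrix.transpose_mul, Matrix.transpose_mul, hA.eq, hH.eq, Matrix.mul_assoc]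
  have hq (v : Fin m → ℝ) : (fun i ↦ (v i : ℂ)) ⬝ᵥ Q.mulVec (fun i ↦ (v i : ℂ)) = 0 := by
    rw [hQ, ← Matrix.mulVec_mulVec, ← Matrix.mulVec_mulVec, Matrix.dotProduct_mulVec,
      ← Matrix.mulVec_transpose, hH.eq, ← h v]
    simp only [dotProduct, Matrix.mulVec, Finset.mul_sum (s := Finset.univ)]
    refine Finset.sum_congr rfl fun i _ ↦ ?_
    simp only [← Finset.mul_sum]
    rw [Finset.mul_sum]
    refine Finset.sum_congr rfl fun j _ ↦ ?_
    simp only [mul_comm (H _ _)]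
    ring
  have hbil (v w : Fin m → ℝ) : (fun i ↦ (v i : ℂ)) ⬝ᵥ Q.mulVec (fun i ↦ (w i : ℂ)) = 0 := by
    have h1 := hq (v + w)
    have e : (fun i ↦ (((v + w) i : ℝ) : ℂ)) = (fun i ↦ (v i : ℂ)) + fun i ↦ (w i : ℂ) := by
      ext i; simp
    have hsymm : (fun i ↦ (w i : ℂ)) ⬝ᵥ Q.mulVec (fun i ↦ (v i : ℂ)) =
        (fun i ↦ (v i : ℂ)) ⬝ᵥ Q.mulVec (fun i ↦ (w i : ℂ)) := by
      rw [Matrix.dotProduct_mulVec, ← Matrix.mulVec_transpose, hQs.eq, dotProduct_comm]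
    rw [e, Matrix.mulVec_add, add_dotProduct, dotProduct_add, dotProduct_add, hq, hq, hsymm] at h1
    linear_combination h1 / 2
  have hQ0 : Q = 0 := by
    ext i j
    have := hbil (Pi.single i 1) (Pi.single j 1)
    have e (k : Fin m) : (fun i ↦ ((Pi.single k (1 : ℝ) : Fin m → ℝ) i : ℂ)) = Pi.single k 1 := by
      ext l
      by_cases hl : l = k
      · subst hl; simp
      · simp [hl]
    rw [e, e] at this
    simpa using this
  have hnil : IsNilpotent (A * H) := ⟨2, by
    rw [pow_two, Matrix.mul_assoc, ← Matrix.mul_assoc H A H, ← hQ, hQ0, Matrix.mul_zero]⟩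
  have htr := (Matrix.isNilpotent_trace_of_isNilpotent hnil).eq_zero
  rw [← htr]
  simp only [Matrix.trace, Matrix.diag, Matrix.mul_apply]
  exact Finset.sum_congr rfl fun i _ ↦ Finset.sum_congr rfl fun j _ ↦ by rw [hH.apply i j]

/-- Writing `A = Bᵀ B` turns the trace into a sum of values of the quadratic form of `S` at the rows
of `B`. -/
theorem sum_mul_nonpos_of_quadratic_nonpos {A S : Matrix (Fin m) (Fin m) ℝ} (hA : A.PosSemidef)
    (h : ∀ v : Fin m → ℝ, ∑ i, ∑ j, v i * v j * S i j ≤ 0) :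
    ∑ i, ∑ j, A i j * S i j ≤ 0 := by
  obtain ⟨B, hB⟩ : ∃ B : Matrix (Fin m) (Fin m) ℝ, A = B.conjTranspose * B := by
    open scoped MatrixOrder in
    exact CStarAlgebra.nonneg_iff_eq_star_mul_self.1 hA.nonneg
  have e : ∑ i, ∑ j, A i j * S i j = ∑ k, ∑ i, ∑ j, B k i * B k j * S i j := by
    simp only [hB, Matrix.mul_apply, Matrix.conjTranspose_apply, star_trivial, Finset.sum_mul]
    exact (Finset.sum_congr rfl fun i _ ↦ Finset.sum_comm).trans Finset.sum_comm
  rw [e]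
  exact Finset.sum_nonpos fun k _ ↦ h _

theorem hasDerivAt_line {V W : Type*} [NormedAddCommGroup V] [NormedSpace ℝ V]
    [NormedAddCommGroup W] [NormedSpace ℝ W] {F : V → W} {y v : V} {t : ℝ}
    (hF : DifferentiableAt ℝ F (y + t • v)) :
    HasDerivAt (fun s : ℝ ↦ F (y + s • v)) (fderiv ℝ F (y + t • v) v) t := by
  have h1 : HasDerivAt (fun s : ℝ ↦ y + s • v) v t := by
    simpa using ((hasDerivAt_id t).smul_const v).const_add y
  exact hF.hasFDerivAt.comp_hasDerivAt t h1

/-- A positive second derivative would make `t` a local minimum as well, so `n` would be constant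
near `t` and its second derivative zero. -/
theorem deriv_deriv_nonpos_of_isLocalMax {n : ℝ → ℝ} {t : ℝ} (h : IsLocalMax n t)
    (hc : ContinuousAt n t) : deriv (deriv n) t ≤ 0 := by
  by_contra! hpos
  have h1 := isLocalMin_of_deriv_deriv_pos hpos h.deriv_eq_zero hc
  have h2 : n =ᶠ[nhds t] fun _ ↦ n t := by
    filter_upwards [h, h1] with s hs hs' using le_antisymm hs hs'
  have h3 : deriv n =ᶠ[nhds t] fun _ ↦ 0 := by
    simpa using h2.deriv
  rw [h3.deriv_eq] at hpos
  simp at hpos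

/-- The first and second order conditions at a local maximum of `|F|²`. -/
theorem normSq_local_max {V : Type*} [NormedAddCommGroup V] [NormedSpace ℝ V] {F : V → ℂ} {y : V}
    (hF : ContDiffAt ℝ ∞ F y) (hmax : IsLocalMax (fun z ↦ Complex.normSq (F z)) y) (v : V) :
    (starRingEnd ℂ (F y) * fderiv ℝ F y v).re = 0 ∧
    (starRingEnd ℂ (F y) * fderiv ℝ (fun z ↦ fderiv ℝ F z v) y v).re +
      Complex.normSq (fderiv ℝ F y v) ≤ 0 := by
  have hline : Filter.Tendsto (fun t : ℝ ↦ y + t • v) (nhds 0) (nhds y) := by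
    have : ContinuousAt (fun t : ℝ ↦ y + t • v) 0 := by fun_prop
    simpa [ContinuousAt] using this
  have hd : ∀ᶠ z in nhds y, DifferentiableAt ℝ F z :=
    ((hF.of_le (m := 1) (by simp)).eventually (by simp)).mono fun z hz ↦
      hz.differentiableAt (by simp)
  have hd2 : DifferentiableAt ℝ (fun z ↦ fderiv ℝ F z v) y :=
    ((hF.fderiv_right (m := ∞) (by simp)).differentiableAt (by simp)).clm_apply
      (differentiableAt_const v)
  set n : ℝ → ℝ := fun t ↦ Complex.normSq (F (y + t • v)) with hn
  -- Along a line, `(|F|²)' = 2 Re(conj F * F')`. It is needed in a neighbourhood of `0`, since it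
  -- is differentiated once more.
  have hn1 : ∀ᶠ t in nhds (0 : ℝ), HasDerivAt n
      (2 * (starRingEnd ℂ (F (y + t • v)) * fderiv ℝ F (y + t • v) v).re) t := by
    filter_upwards [hline.eventually hd] with t ht
    have h1 := hasDerivAt_line (v := v) ht
    have hre := Complex.reCLM.hasFDerivAt.comp_hasDerivAt t h1
    have him := Complex.imCLM.hasFDerivAt.comp_hasDerivAt t h1
    have := (hre.mul hre).add (him.mul him)
    refine this.congr_deriv ?_
    simp
    ring
  have hloc : IsLocalMax n 0 := by
    have := hline.eventually hmax
    filter_upwards [this] with t ht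
    simpa [hn] using ht
  have hfirst := hloc.hasDerivAt_eq_zero hn1.self_of_nhds
  have hF0 : DifferentiableAt ℝ F (y + (0 : ℝ) • v) := by simpa using hd.self_of_nhds
  have hd20 : DifferentiableAt ℝ (fun z ↦ fderiv ℝ F z v) (y + (0 : ℝ) • v) := by simpa using hd2
  have hsecond : HasDerivAt
      (fun t : ℝ ↦ 2 * (starRingEnd ℂ (F (y + t • v)) * fderiv ℝ F (y + t • v) v).re)
      (2 * ((starRingEnd ℂ (F y) * fderiv ℝ (fun z ↦ fderiv ℝ F z v) y v).re +
        Complex.normSq (fderiv ℝ F y v))) 0 := by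
    have h1 := hasDerivAt_line (v := v) hF0
    have h2 := hasDerivAt_line (v := v) hd20
    have h3 := (Complex.conjCLE.toContinuousLinearMap.hasFDerivAt.comp_hasDerivAt 0 h1).mul h2
    have h4 := (Complex.reCLM.hasFDerivAt.comp_hasDerivAt 0 h3).const_mul 2
    refine h4.congr_deriv ?_
    simp [Complex.normSq_apply]
    ring
  have hder : deriv n =ᶠ[nhds 0]
      fun t : ℝ ↦ 2 * (starRingEnd ℂ (F (y + t • v)) * fderiv ℝ F (y + t • v) v).re :=
    hn1.mono fun t ht ↦ ht.deriv
  have h2 := deriv_deriv_nonpos_of_isLocalMax hloc hn1.self_of_nhds.continuousAt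
  rw [hder.deriv_eq, hsecond.deriv] at h2
  simp only [zero_smul, add_zero] at hfirst
  exact ⟨by linarith, by linarith⟩

end Pointwise

/-! ### Analysis at a maximum point of the modulus -/

section MaximumPrinciple

variable {g : Metric m M} {e : OpenPartialHomeomorph M (EuclideanSpace ℝ (Fin m))}

/-- The second partial derivative `∂²φ/∂xⱼ∂xᵢ` of a complex function in the coordinates of a
chart. -/
def chartHessian (e : OpenPartialHomeomorph M (EuclideanSpace ℝ (Fin m))) (φ : M → ℂ)
    (y : EuclideanSpace ℝ (Fin m)) : Matrix (Fin m) (Fin m) ℂ :=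
  Matrix.of fun i j ↦ fderiv ℝ (chartDeriv e φ i) y (EuclideanSpace.single j (1 : ℝ))

theorem clm_toLp {W : Type*} [NormedAddCommGroup W] [NormedSpace ℝ W]
    (L : EuclideanSpace ℝ (Fin m) →L[ℝ] W) (v : Fin m → ℝ) :
    L (WithLp.toLp 2 v) = ∑ i, v i • L (EuclideanSpace.single i 1) := by
  have h : (WithLp.toLp 2 v : EuclideanSpace ℝ (Fin m)) =
      ∑ i, v i • EuclideanSpace.single i (1 : ℝ) := by
    ext j
    simp [Finset.sum_apply, Pi.single_apply]
  rw [h, map_sum]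
  simp

theorem differentiableAt_chartDeriv (he : e ∈ IsManifold.maximalAtlas (𝓡 m) ∞ M) {φ : M → ℂ}
    (hφ : ContMDiff (𝓡 m) 𝓘(ℝ, ℂ) ∞ φ) (i : Fin m) {y : EuclideanSpace ℝ (Fin m)}
    (hy : y ∈ e.target) : DifferentiableAt ℝ (chartDeriv e φ i) y :=
  ((contDiffOn_chartDeriv he hφ i).contDiffAt (e.open_target.mem_nhds hy)).differentiableAt
    (by simp)

theorem isSymm_chartHessian (he : e ∈ IsManifold.maximalAtlas (𝓡 m) ∞ M) {φ : M → ℂ}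
    (hφ : ContMDiff (𝓡 m) 𝓘(ℝ, ℂ) ∞ φ) {y : EuclideanSpace ℝ (Fin m)} (hy : y ∈ e.target) :
    (chartHessian e φ y).IsSymm := by
  have hF : ContDiffAt ℝ ∞ (fun z ↦ φ (e.symm z)) y :=
    (contDiffOn_comp_symm he hφ).contDiffAt (e.open_target.mem_nhds hy)
  have hd : DifferentiableAt ℝ (fderiv ℝ fun z ↦ φ (e.symm z)) y :=
    (hF.fderiv_right (m := ∞) (by simp)).differentiableAt (by simp)
  have h (i j : Fin m) : chartHessian e φ y i j =
      fderiv ℝ (fderiv ℝ fun z ↦ φ (e.symm z)) y (EuclideanSpace.single j 1)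
        (EuclideanSpace.single i 1) := by
    have := (hd.hasFDerivAt.clm_apply
      (hasFDerivAt_const (EuclideanSpace.single i (1 : ℝ)) y)).fderiv
    simp only [chartHessian, Matrix.of_apply]
    change fderiv ℝ (fun z ↦ fderiv ℝ (fun z ↦ φ (e.symm z)) z (EuclideanSpace.single i (1 : ℝ)))
      y _ = _
    rw [this]
    simp
  ext i j
  rw [Matrix.transpose_apply, h, h]
  exact hF.isSymmSndFDerivAt (by
    rw [minSmoothness_of_isRCLikeNormedField]; exact WithTop.coe_le_coe.2 (le_top : (2 : ℕ∞) ≤ ⊤)) _ _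

/-- The Laplace-Beltrami operator is the trace of the Hessian up to first order terms. -/
theorem exists_laplacian_eq (g : Metric m M) (he : e ∈ IsManifold.maximalAtlas (𝓡 m) ∞ M)
    {φ : M → ℂ} (hφ : ContMDiff (𝓡 m) 𝓘(ℝ, ℂ) ∞ φ) {x : M} (hx : x ∈ e.source) :
    ∃ b : Fin m → ℝ, laplacianInChart g e φ x =
      ∑ i, ∑ j, ((metricMatrix g e (e x))⁻¹ i j : ℂ) * chartHessian e φ (e x) i j +
        ∑ i, (b i : ℂ) * chartDeriv e φ i (e x) := by
  have hy := e.map_source hx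
  set y := e x
  set w : Fin m → Fin m → EuclideanSpace ℝ (Fin m) → ℝ := fun i j y ↦
    (metricMatrix g e y)⁻¹ i j * √((metricMatrix g e y).det) with hw
  set s := √((metricMatrix g e y).det) with hs
  have hs0 : (s : ℂ) ≠ 0 :=
    Complex.ofReal_ne_zero.2 (Real.sqrt_pos.2 (posDef_metricMatrix g he hy).det_pos).ne'
  have hwd (i j : Fin m) : DifferentiableAt ℝ (w i j) y :=
    (((contDiffOn_inv_metricMatrix g he i j).mul
      (contDiffOn_sqrt_det_metricMatrix g he)).contDiffAt
        (e.open_target.mem_nhds hy)).differentiableAt (by simp)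
  -- The coefficients come from the derivative falling on the weight `g^{ij} √|g|`. That they are
  -- real is what later removes these terms at a maximum.
  refine ⟨fun i ↦ ∑ j, 1 / s * fderiv ℝ (w i j) y (EuclideanSpace.single j 1), ?_⟩
  simp only [laplacianInChart, Complex.ofReal_sum, Finset.sum_mul, ← Finset.sum_add_distrib]
  refine Finset.sum_congr rfl fun i _ ↦ Finset.sum_congr rfl fun j _ ↦ ?_
  have h1 : HasFDerivAt (fun z ↦ ((w i j z : ℝ) : ℂ))
      (Complex.ofRealCLM.comp (fderiv ℝ (w i j) y)) y :=
    Complex.ofRealCLM.hasFDerivAt.comp y (hwd i j).hasFDerivAt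
  have h2 := (h1.mul (differentiableAt_chartDeriv he hφ i hy).hasFDerivAt).fderiv
  change ((1 / s : ℝ) : ℂ) * fderiv ℝ (fun z ↦ ((w i j z : ℝ) : ℂ) * chartDeriv e φ i z) y
    (EuclideanSpace.single j 1) = _
  rw [show (fun z ↦ ((w i j z : ℝ) : ℂ) * chartDeriv e φ i z) =
    (fun z ↦ ((w i j z : ℝ) : ℂ)) * chartDeriv e φ i from rfl, h2]
  simp only [add_apply, smul_apply, smul_eq_mul,
    ContinuousLinearMap.comp_apply, Complex.ofRealCLM_apply, hw, chartHessian, Matrix.of_apply]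
  rw [← hs]
  push_cast
  field_simp

/-- If `κ(φ, φ)` vanishes identically near a critical point of `φ`, the trace of the Hessian
vanishes there. -/
theorem trace_chartHessian_eq_zero (g : Metric m M) (he : e ∈ IsManifold.maximalAtlas (𝓡 m) ∞ M)
    {φ : M → ℂ} (hφ : ContMDiff (𝓡 m) 𝓘(ℝ, ℂ) ∞ φ) (hκ : ∀ x, conformality g φ φ x = 0)
    {y : EuclideanSpace ℝ (Fin m)} (hy : y ∈ e.target) (hcrit : ∀ i, chartDeriv e φ i y = 0) :
    ∑ i, ∑ j, ((metricMatrix g e y)⁻¹ i j : ℂ) * chartHessian e φ y i j = 0 := by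
  have hAs : ((metricMatrix g e y)⁻¹.map ((↑) : ℝ → ℂ)).IsSymm := by
    ext i j
    have := (posDef_metricMatrix g he hy).inv.isHermitian.apply i j
    simp only [star_trivial] at this
    simp [this]
  refine sum_mul_eq_zero_of_quadratic_eq_zero _ _ hAs (isSymm_chartHessian he hφ hy) fun v ↦ ?_
  set u : EuclideanSpace ℝ (Fin m) := WithLp.toLp 2 v with hu
  have hline : Filter.Tendsto (fun t : ℝ ↦ y + t • u) (nhds 0) (nhds y) := by
    have : ContinuousAt (fun t : ℝ ↦ y + t • u) 0 := by fun_prop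
    simpa [ContinuousAt] using this
  -- At a critical point the first derivatives along `y + t u` are `t (H v)ᵢ + o(t)`. So `κ(φ, φ) /
  -- t²` tends to the quadratic form required, while being identically zero.
  have hD (i : Fin m) : Filter.Tendsto (fun t : ℝ ↦ (t : ℂ)⁻¹ * chartDeriv e φ i (y + t • u))
      (nhdsWithin 0 {0}ᶜ) (nhds (∑ k, (v k : ℂ) * chartHessian e φ y i k)) := by
    have h1 := hasDerivAt_line (v := u) (t := 0) (y := y) (F := chartDeriv e φ i)
      (by simpa using differentiableAt_chartDeriv he hφ i hy)
    rw [hasDerivAt_iff_tendsto_slope_zero, zero_smul, add_zero, hu, clm_toLp] at h1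
    simpa [hcrit, chartHessian] using h1
  have hA (i j : Fin m) : Filter.Tendsto
      (fun t : ℝ ↦ (((metricMatrix g e (y + t • u))⁻¹ i j : ℝ) : ℂ))
      (nhdsWithin 0 {0}ᶜ) (nhds (((metricMatrix g e y)⁻¹ i j : ℝ) : ℂ)) := by
    have h1 := ((contDiffOn_inv_metricMatrix g he i j).continuousOn.continuousAt
      (e.open_target.mem_nhds hy)).tendsto.comp hline
    exact (Complex.continuous_ofReal.continuousAt.tendsto.comp h1).mono_left nhdsWithin_le_nhds
  have hlim := tendsto_finsetSum Finset.univ fun i _ ↦ tendsto_finsetSum Finset.univ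
    fun j _ ↦ (hA i j).mul ((hD i).mul (hD j))
  refine tendsto_nhds_unique (hlim.congr' ?_) tendsto_const_nhds
  refine Filter.Eventually.filter_mono nhdsWithin_le_nhds ?_
  filter_upwards [hline.eventually (e.open_target.mem_nhds hy)] with t ht
  have h1 := conformality_symm_apply g he hφ hφ ht
  rw [hκ] at h1
  have h2 : ∑ i, ∑ j, (((metricMatrix g e (y + t • u))⁻¹ i j : ℝ) : ℂ) *
      (((t : ℂ)⁻¹ * chartDeriv e φ i (y + t • u)) * ((t : ℂ)⁻¹ * chartDeriv e φ j (y + t • u))) =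
      ((t : ℂ)⁻¹) ^ 2 * ∑ i, ∑ j, (((metricMatrix g e (y + t • u))⁻¹ i j : ℝ) : ℂ) *
        (chartDeriv e φ i (y + t • u) * chartDeriv e φ j (y + t • u)) := by
    simp only [Finset.mul_sum]
    exact Finset.sum_congr rfl fun i _ ↦ Finset.sum_congr rfl fun j _ ↦ by ring
  rw [h2, ← h1, mul_zero]

/-- The relations between the eigenvalues that are visible at a maximum point of `|f|`. -/
theorem IsEigenfunction.of_isMax {lam mu : ℂ} {f : M → ℂ} (hf : IsEigenfunction g lam mu f) {p : M}
    (hmax : ∀ x, Complex.normSq (f x) ≤ Complex.normSq (f p)) (hp : f p ≠ 0) :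
    mu.im = 0 ∧ mu.re ≤ 0 ∧ lam.re ≤ mu.re ∧ (mu = 0 → lam = 0) := by
  set e := chartAt (EuclideanSpace ℝ (Fin m)) p
  have he : e ∈ IsManifold.maximalAtlas (𝓡 m) ∞ M := chart_mem p
  have hpe : p ∈ e.source := mem_chart_source _ p
  have hy := e.map_source hpe
  obtain ⟨b, hb⟩ := exists_laplacian_eq g he hf.smooth hpe
  have hlam := hf.laplacian e he p hpe
  have hkap := hf.conformality p
  rw [conformality_apply g he hf.smooth hf.smooth hpe] at hkap
  set y := e p
  set A := (metricMatrix g e y)⁻¹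
  set H := chartHessian e f y with hH
  set D : Fin m → ℂ := fun i ↦ chartDeriv e f i y with hD
  set c := f p
  rw [hlam] at hb
  have hApos : A.PosDef := (posDef_metricMatrix g he hy).inv
  have hF : ContDiffAt ℝ ∞ (fun z ↦ f (e.symm z)) y :=
    (contDiffOn_comp_symm he hf.smooth).contDiffAt (e.open_target.mem_nhds hy)
  have hlocmax : IsLocalMax (fun z ↦ Complex.normSq (f (e.symm z))) y :=
    Filter.Eventually.of_forall fun z ↦ by
      simpa only [y, e.left_inv hpe] using hmax (e.symm z)
  have hN : 0 < Complex.normSq c := Complex.normSq_pos.2 hp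
  have hder (z : EuclideanSpace ℝ (Fin m)) (v : Fin m → ℝ) :
      fderiv ℝ (fun z ↦ f (e.symm z)) z (WithLp.toLp 2 v) = ∑ i, v i • chartDeriv e f i z :=
    clm_toLp _ v
  have hder2 (v : Fin m → ℝ) :
      fderiv ℝ (fun z ↦ fderiv ℝ (fun z ↦ f (e.symm z)) z (WithLp.toLp 2 v)) y (WithLp.toLp 2 v) =
        ∑ i, ∑ j, ((v i * v j : ℝ) : ℂ) * H i j := by
    simp only [hder]
    have hd (i : Fin m) : DifferentiableAt ℝ (fun z ↦ v i • chartDeriv e f i z) y :=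
      (differentiableAt_chartDeriv he hf.smooth i hy).const_smul (v i)
    rw [fderiv_fun_sum fun i _ ↦ hd i, sum_apply]
    refine Finset.sum_congr rfl fun i _ ↦ ?_
    rw [fderiv_fun_const_smul (differentiableAt_chartDeriv he hf.smooth i hy),
      smul_apply, clm_toLp, Finset.smul_sum]
    refine Finset.sum_congr rfl fun j _ ↦ ?_
    simp [hH, chartHessian, mul_assoc]
  have hmax1 (v : Fin m → ℝ) := normSq_local_max hF hlocmax (WithLp.toLp 2 v)
  simp only [hder2] at hmax1
  simp only [hder, y, e.left_inv hpe] at hmax1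
  have hre (i : Fin m) : (starRingEnd ℂ c * D i).re = 0 := by
    have := (hmax1 (Pi.single i 1)).1
    simpa [Pi.single_apply, hD] using this
  -- The real covector `ζ` is the logarithmic derivative of `f` divided by `I`, in other words the
  -- differential of its phase at `p`.
  set ζ : Fin m → ℝ := fun i ↦ (starRingEnd ℂ c * D i).im / Complex.normSq c with hζ
  have hDζ (i : Fin m) : D i = Complex.I * c * ζ i := by
    have h1 : starRingEnd ℂ c * D i = (starRingEnd ℂ c * D i).im * Complex.I := by
      have h := Complex.re_add_im (starRingEnd ℂ c * D i)
      rw [hre, Complex.ofReal_zero, zero_add] at h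
      exact h.symm
    have h2 : starRingEnd ℂ c ≠ 0 := by simpa using hp
    have h3 : (Complex.normSq c : ℂ) ≠ 0 := Complex.ofReal_ne_zero.2 hN.ne'
    apply mul_left_cancel₀ h2
    rw [h1, hζ]
    push_cast
    rw [Complex.normSq_eq_conj_mul_self] at h3 ⊢
    field_simp
  set q := ∑ i, ∑ j, A i j * (ζ i * ζ j) with hq
  have hqmu : mu = ((-q : ℝ) : ℂ) := by
    have h1 : ∑ i, ∑ j, (A i j : ℂ) * (D i * D j) = -(q : ℂ) * c ^ 2 := by
      rw [hq]
      push_cast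
      simp only [← Finset.sum_neg_distrib, Finset.sum_mul, hDζ]
      refine Finset.sum_congr rfl fun i _ ↦ Finset.sum_congr rfl fun j _ ↦ ?_
      linear_combination (A i j * c ^ 2 * ζ i * ζ j : ℂ) * Complex.I_sq
    have h2 : mu * c ^ 2 = -(q : ℂ) * c ^ 2 := hkap.symm.trans h1
    rw [mul_right_cancel₀ (pow_ne_zero 2 hp) h2]
    push_cast
    rfl
  have hqdot : q = ζ ⬝ᵥ A.mulVec ζ := by
    simp only [hq, dotProduct, Matrix.mulVec, Finset.mul_sum]
    exact Finset.sum_congr rfl fun i _ ↦ Finset.sum_congr rfl fun j _ ↦ by ring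
  have hq0 : 0 ≤ q := by
    rw [hqdot]
    simpa using hApos.posSemidef.dotProduct_mulVec_nonneg ζ
  refine ⟨by simp [hqmu], by simp [hqmu, hq0], ?_, fun hmu ↦ ?_⟩
  -- The second-order condition holds for every real direction `v`, with `|df(v)|² = |c|² ζ(v)²`;
  -- tracing it against the positive matrix `A` brings in the Laplacian.
  · have hquad : ∑ i, ∑ j, A i j *
        ((starRingEnd ℂ c * H i j).re + Complex.normSq c * (ζ i * ζ j)) ≤ 0 := by
      refine sum_mul_nonpos_of_quadratic_nonpos (S := Matrix.of fun i j ↦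
        (starRingEnd ℂ c * H i j).re + Complex.normSq c * (ζ i * ζ j)) hApos.posSemidef fun v ↦ ?_
      have h1 := (hmax1 v).2
      have h2 : ∑ i, v i • D i = Complex.I * c * ((∑ i, v i * ζ i : ℝ) : ℂ) := by
        push_cast
        rw [Finset.mul_sum]
        refine Finset.sum_congr rfl fun i _ ↦ ?_
        rw [hDζ, Complex.real_smul]
        ring
      have h3 : (∑ i, v i * ζ i) * (∑ i, v i * ζ i) = ∑ i, ∑ j, v i * v j * (ζ i * ζ j) := by
        rw [Finset.sum_mul_sum]
        exact Finset.sum_congr rfl fun i _ ↦ Finset.sum_congr rfl fun j _ ↦ by ring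
      have h4 : (starRingEnd ℂ c * ∑ i, ∑ j, ((v i * v j : ℝ) : ℂ) * H i j).re =
          ∑ i, ∑ j, v i * v j * (starRingEnd ℂ c * H i j).re := by
        simp only [Finset.mul_sum, Complex.re_sum]
        refine Finset.sum_congr rfl fun i _ ↦ Finset.sum_congr rfl fun j _ ↦ ?_
        rw [mul_left_comm, Complex.re_ofReal_mul]
      have h5 : Complex.normSq (∑ i, v i • D i) =
          Complex.normSq c * ∑ i, ∑ j, v i * v j * (ζ i * ζ j) := by
        rw [h2, map_mul, map_mul, Complex.normSq_I, Complex.normSq_ofReal, h3, one_mul]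
      refine le_of_eq_of_le ?_ h1
      rw [h4]
      refine Eq.trans ?_ (congrArg _ h5.symm)
      simp only [Finset.mul_sum, ← Finset.sum_add_distrib, Matrix.of_apply]
      exact Finset.sum_congr rfl fun i _ ↦ Finset.sum_congr rfl fun j _ ↦ by ring
    have htr : (starRingEnd ℂ c * ∑ i, ∑ j, (A i j : ℂ) * H i j).re = lam.re * Complex.normSq c := by
      have h1 : ∑ i, ∑ j, (A i j : ℂ) * H i j = lam * c - ∑ i, (b i : ℂ) * D i :=
        eq_sub_of_add_eq hb.symm
      have h2 : starRingEnd ℂ c * (lam * c) = lam * (Complex.normSq c : ℂ) := by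
        rw [Complex.normSq_eq_conj_mul_self]
        ring
      -- Real multiples of the purely imaginary numbers `conj c * D i`.
      have h3 : (starRingEnd ℂ c * ∑ i, (b i : ℂ) * D i).re = 0 := by
        rw [Finset.mul_sum, Complex.re_sum]
        refine Finset.sum_eq_zero fun i _ ↦ ?_
        rw [mul_left_comm, Complex.re_ofReal_mul, hre, mul_zero]
      rw [h1, mul_sub, Complex.sub_re, h3, h2, Complex.re_mul_ofReal, sub_zero]
    have hsum : ∑ i, ∑ j, A i j *
        ((starRingEnd ℂ c * H i j).re + Complex.normSq c * (ζ i * ζ j)) =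
        (lam.re + q) * Complex.normSq c := by
      rw [add_mul, ← htr, hq]
      simp only [Finset.mul_sum, Finset.sum_mul, Complex.re_sum, ← Finset.sum_add_distrib]
      refine Finset.sum_congr rfl fun i _ ↦ Finset.sum_congr rfl fun j _ ↦ ?_
      rw [mul_left_comm (starRingEnd ℂ c), Complex.re_ofReal_mul]
      ring
    rw [hsum] at hquad
    have := nonpos_of_mul_nonpos_left hquad hN
    rw [hqmu, Complex.ofReal_re]
    linarith
  -- With `mu = 0`, positive definiteness gives `ζ = 0`, so `p` is critical. As `κ(f, f)` is zero
  -- everywhere, both the Hessian trace and the first-order part of `Δf` vanish at `p`.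
  · have hq1 : q = 0 := by
      rw [hmu] at hqmu
      simpa using (Complex.ofReal_eq_zero.1 hqmu.symm)
    have hζ0 : ζ = 0 := by
      by_contra h
      have := hApos.dotProduct_mulVec_pos h
      rw [star_trivial, ← hqdot] at this
      exact this.ne' hq1
    have hcrit (i : Fin m) : D i = 0 := by simp [hDζ i, hζ0]
    have htr := trace_chartHessian_eq_zero g he hf.smooth
      (fun x ↦ by rw [hf.conformality, hmu, zero_mul]) hy hcrit
    have hsum : ∑ i, (b i : ℂ) * D i = 0 := Finset.sum_eq_zero fun i _ ↦ by rw [hcrit, mul_zero]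
    have h2 : lam * c = 0 :=
      hb.trans ((congrArg₂ (· + ·) htr hsum).trans (add_zero 0))
    exact (mul_eq_zero.1 h2).resolve_right hp

end MaximumPrinciple

end RiemannianEigen

end

/-! ### The eigenvalue inequality -/

theorem mainTheorem1 {m : ℕ} {M : Type*} [TopologicalSpace M] [T2Space M] [CompactSpace M]
    [ChartedSpace (EuclideanSpace ℝ (Fin m)) M] [IsManifold (𝓡 m) ∞ M]
    (g : RiemannianEigen.Metric m M) (lam mu : ℂ) (f : M → ℂ)
    (hf : RiemannianEigen.IsEigenfunction g lam mu f) (hconst : ¬ IsLocallyConstant f) :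
    lam.im = 0 ∧ mu.im = 0 ∧ lam.re ≤ mu.re ∧ mu.re < 0 := by
  obtain ⟨hlam, hlam0⟩ := RiemannianEigen.laplacian_eigenvalue hf.smooth hf.laplacian hconst
  obtain ⟨x₀, hx₀⟩ : ∃ x, f x ≠ 0 := by
    by_contra! h
    exact hconst (funext h ▸ IsLocallyConstant.const (0 : ℂ))
  obtain ⟨p, -, hp⟩ := isCompact_univ.exists_isMaxOn ⟨x₀, Set.mem_univ x₀⟩
    (Complex.continuous_normSq.comp hf.smooth.continuous).continuousOn
  have hmax : ∀ x, Complex.normSq (f x) ≤ Complex.normSq (f p) := fun x ↦ hp (Set.mem_univ x)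
  have hfp : f p ≠ 0 := Complex.normSq_pos.1 ((Complex.normSq_pos.2 hx₀).trans_le (hmax x₀))
  obtain ⟨h1, h2, h3, h4⟩ := hf.of_isMax hmax hfp
  -- Strictness: `mu.re = 0` together with `mu.im = 0` means `mu = 0`, which forces `lam = 0` and
  -- contradicts the global argument.
  exact ⟨hlam, h1, h3, h2.lt_of_ne fun h ↦ hlam0 (h4 (Complex.ext h h1))⟩
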